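/- Let $\mathcal M=(M,<,\ldots)$ be a first-order structure expanding a nonempty dense linear order without endpoints. Equip $M$ with the order topology and $M^n$ with the product topology; "definable" means definable in $\mathcal M$ with parameters. A coordinate projection is a map $M^n\to M^d$ selecting $d$ distinct coordinates, and a set is discrete if its subspace topology is discrete. Suppose that - $\mathcal M$ is locally o-minimal: for every definable $X\subseteq M$ and every $a\in M$ there is an open interval $I\ni a$ such that $X\cap I$ is a finite union of points and open intervals; - $\mathcal M$ is definably complete: every definable subset of $M$ has a supremum and an infimum in $M\cup\{\pm\infty\}$; - the image of every nonempty definable discrete set $X\subseteq M^n$ under every coordinate projection is discrete. For a nonempty definable set $X\subseteq M^n$, let $\dim X$ be the largest integer $d\ge 0$ such that $\pi(X)$ has nonempty interior in $M^d$ for some coordinate projection $\pi:M^n\to M^d$; put $\dim\emptyset=-\infty$. Let $X\subseteq M^m$ and $Y\subseteq M^n$ be definable sets and let $\varphi:X\to Y$ be a definable surjective map (that is, its graph is definable) such that $\dim\varphi^{-1}(y)$ is the same for all $y\in Y$. Then $$\dim X=\dim Y+\dim\varphi^{-1}(y)\qquad\text{for all } y\in Y.$$ -/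

import Mathlib

universe u v w

namespace LocOMin

/-- A subset of `M^α` is definable in the structure, with parameters from `M`. -/
def Def (L : FirstOrder.Language.{u, v}) {M : Type w} [L.Structure M] {α : Type} (X : Set (α → M)) : Prop :=
  (Set.univ : Set M).Definable L X

/-- A subset of `M` is definable in the structure, with parameters from `M`. -/
def Def₁ (L : FirstOrder.Language.{u, v}) {M : Type w} [L.Structure M] (X : Set M) : Prop :=
  (Set.univ : Set M).Definable₁ L X

/-- The coordinate projection `M^n → M^d` onto the `d` distinct coordinates `σ 0, …, σ (d - 1)`. -/
def proj {M : Type w} {n d : ℕ} (σ : Fin d ↪ Fin n) (x : Fin n → M) : Fin d → M :=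
  fun i => x (σ i)

/-- Local o-minimality: near every point of `M`, every definable subset of `M` is a finite union
of points and open intervals. -/
def LocallyOMinimal (L : FirstOrder.Language.{u, v}) (M : Type w) [LinearOrder M] [L.Structure M] : Prop :=
  ∀ X : Set M, Def₁ L X → ∀ a : M, ∃ b c : M, a ∈ Set.Ioo b c ∧
    ∃ (P : Finset M) (I : Finset (M × M)),
      X ∩ Set.Ioo b c = (P : Set M) ∪ ⋃ p ∈ I, Set.Ioo p.1 p.2

/-- Definable completeness: every definable subset of `M` has a supremum and an infimum in
`M ∪ {±∞}`. Only nonempty sets that are bounded on the relevant side need to be mentioned: in all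
other cases the supremum (infimum) exists and is `+∞` or `-∞`, as `M` has no endpoints. -/
def DefinablyComplete (L : FirstOrder.Language.{u, v}) (M : Type w) [LinearOrder M] [L.Structure M] : Prop :=
  ∀ X : Set M, Def₁ L X → X.Nonempty →
    (BddAbove X → ∃ s, IsLUB X s) ∧ (BddBelow X → ∃ s, IsGLB X s)

/-- The image of a nonempty definable discrete set under a coordinate projection is discrete.
A set is discrete when its subspace topology is. -/
def DiscreteImages (L : FirstOrder.Language.{u, v}) (M : Type w) [TopologicalSpace M] [L.Structure M] :
    Prop :=
  ∀ (n d : ℕ) (σ : Fin d ↪ Fin n) (X : Set (Fin n → M)), X.Nonempty → Def L X →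
    IsDiscrete X → IsDiscrete (proj σ '' X)

open Classical in
/-- The dimension of `X ⊆ M^n`: the largest `d` such that the image of `X` under some coordinate
projection `M^n → M^d` has nonempty interior (necessarily `d ≤ n`). For nonempty `X` the number
`d = 0` always qualifies; for empty `X` no `d` does and the dimension is `⊥`, that is `-∞`. -/
noncomputable def dim {M : Type w} [TopologicalSpace M] {n : ℕ} (X : Set (Fin n → M)) :
    WithBot ℕ :=
  ((Finset.range (n + 1)).filter
    fun d => ∃ σ : Fin d ↪ Fin n, (interior (proj σ '' X)).Nonempty).max

/-- A map `φ : X → Y` with `X ⊆ M^m` and `Y ⊆ M^n` is definable: its graph, a subset of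
`M^m × M^n`, is definable. -/
def DefMap (L : FirstOrder.Language.{u, v}) {M : Type w} [L.Structure M] {m n : ℕ}
    {X : Set (Fin m → M)} {Y : Set (Fin n → M)} (φ : X → Y) : Prop :=
  Def L {z : Fin m ⊕ Fin n → M |
    ∃ x : X, z ∘ Sum.inl = (x : Fin m → M) ∧ z ∘ Sum.inr = (φ x : Fin n → M)}

/-- The fiber of `φ : X → Y` at `y`, as a subset of `M^m`. -/
def fiber {M : Type w} {m n : ℕ} {X : Set (Fin m → M)} {Y : Set (Fin n → M)} (φ : X → Y) (y : Y) :
    Set (Fin m → M) :=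
  Subtype.val '' (φ ⁻¹' {y})

end LocOMin

/-! Dimension is treated as a rank. For the graph `G` of the map and a set `C` of coordinates,
`RankGE C G k` asks for at least `k` coordinates from `C` onto which `G` projects with an open box
in the image. The dimensions of the source, the target and the fibres are all ranks of `G` or of its
slices. The coordinates of the source determine those of the target, so the theorem becomes
additivity of rank: the rank on `A ∪ C` is the rank on `A` plus the common rank on `C` of the fibres
over `A`.

The lower bound, `RankGE.union_of_fibers`, must assemble boxes in the fibres over a box into a
single box. This is the Kuratowski–Ulam principle `hasBox_insert`, together with `HasBox.or`, which
makes the choice of fibre coordinates uniform. Its core is `exists_hasIoo_section`: intervals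
attached to all points of an interval have a common point over some subinterval. The tools behind it
are monotonicity of definable families of initial segments (`exists_monotone_subinterval`), which
stand in for definable functions, and `false_of_strictly_ordered_family`.

The upper bound, `RankGE.of_union_of_fibers`, removes the coordinates of `C` one at a time,
splitting the set by whether the fibre in that coordinate contains an interval. If it does, the
fibre rank falls along with the total rank. If it does not, `exists_hasIoo_of_discrete_fibers`
exchanges the coordinate for a remaining one; this exchange is what requires images of discrete sets
to be discrete. -/

namespace LocOMin

open Filter Topology

set_option linter.unusedSectionVars false

/-! ### Definable predicates and functions, closed under first-order operations. -/

section Definability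

variable (L : FirstOrder.Language.{u, v}) {M : Type w} [L.Structure M]

/-- A definable predicate on `M^α`; instance search proves definability. -/
class DefP {α : Type} (P : (α → M) → Prop) : Prop where
  out : Def L {v | P v}

/-- A definable function `M^α → M`. -/
class DefF {α : Type} (t : (α → M) → M) : Prop where
  out : (Set.univ : Set M).DefinableFun L t

/-- A definable predicate on `M`. -/
abbrev Def1 (P : M → Prop) : Prop := DefP L fun v : Fin 1 → M => P (v 0)

/-- A definable binary predicate on `M`. -/
abbrev Def2 (P : M → M → Prop) : Prop := DefP L fun v : Fin 2 → M => P (v 0) (v 1)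

/-- A definable predicate on `M^ι × M`. -/
abbrev DefT {ι : Type} (P : (ι → M) → M → Prop) : Prop :=
  DefP L fun v : ι ⊕ Unit → M => P (fun i => v (Sum.inl i)) (v (Sum.inr ()))

section Functions

variable {α β ι : Type}

instance DefF.coord (i : α) : DefF L (fun v : α → M => v i) := ⟨Set.DefinableFun.proj L⟩

instance DefF.const (c : M) : DefF L (fun _ : α → M => c) :=
  ⟨L.definableFun_const α (Set.mem_univ c)⟩

instance DefF.update [DecidableEq ι] (f : (α → M) → ι → M) (t : (α → M) → M) (i j : ι)
    [hf : ∀ j, DefF L fun v => f v j] [ht : DefF L t] :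
    DefF L (fun v => Function.update (f v) i (t v) j) := by
  by_cases h : j = i
  · subst h; simpa using! ht
  · simpa [Function.update_of_ne h] using! hf j

instance DefF.ite (p : Prop) [Decidable p] (f g : (α → M) → M) [hf : DefF L f] [hg : DefF L g] :
    DefF L (fun v => if p then f v else g v) := by
  by_cases h : p
  · simpa [h] using! hf
  · simpa [h] using! hg

end Functions

section Predicates

variable {α β ι : Type}

theorem DefP.comp [Finite β] (P : (β → M) → Prop) [hP : DefP L P] (f : (α → M) → β → M)
    [hf : ∀ j, DefF L fun v => f v j] : DefP L (fun v => P (f v)) :=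
  ⟨hP.out.preimage_map fun i => (hf i).out⟩

theorem DefP.comp1 (P : M → Prop) [hP : Def1 L P] (t : (α → M) → M) [ht : DefF L t] :
    DefP L (fun v => P (t v)) :=
  DefP.comp L (hP := hP) _ fun v _ => t v

theorem DefP.comp2 (P : M → M → Prop) [hP : Def2 L P] (s t : (α → M) → M) [hs : DefF L s]
    [ht : DefF L t] : DefP L (fun v => P (s v) (t v)) := by
  have : ∀ j, DefF L fun v => (![s v, t v] : Fin 2 → M) j := by
    intro j; fin_cases j
    · exact hs
    · exact ht
  exact DefP.comp L (hP := hP) _ fun v => ![s v, t v]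

theorem DefP.compT [Finite ι] (P : (ι → M) → M → Prop) [hP : DefT L P] (f : (α → M) → ι → M)
    (t : (α → M) → M) [hf : ∀ j, DefF L fun v => f v j] [ht : DefF L t] :
    DefP L (fun v => P (f v) (t v)) := by
  have : ∀ j, DefF L fun v => (Sum.elim (f v) (fun _ => t v) : ι ⊕ Unit → M) j := by
    rintro (j | j)
    · exact hf j
    · exact ht
  exact DefP.comp L (hP := hP) _ fun v => Sum.elim (f v) (fun _ => t v)

instance DefP.const (p : Prop) : DefP L (fun _ : α → M => p) := by
  by_cases h : p
  · exact ⟨by simp [h, Def]⟩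
  · exact ⟨by simp [h, Def]⟩

instance DefP.not (P : (α → M) → Prop) [h : DefP L P] : DefP L (fun v => ¬ P v) :=
  ⟨h.out.compl⟩

instance DefP.and (P Q : (α → M) → Prop) [hP : DefP L P] [hQ : DefP L Q] :
    DefP L (fun v => P v ∧ Q v) :=
  ⟨hP.out.inter hQ.out⟩

instance DefP.or (P Q : (α → M) → Prop) [hP : DefP L P] [hQ : DefP L Q] :
    DefP L (fun v => P v ∨ Q v) :=
  ⟨hP.out.union hQ.out⟩

instance DefP.imp (P Q : (α → M) → Prop) [hP : DefP L P] [hQ : DefP L Q] :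
    DefP L (fun v => P v → Q v) := by
  simpa only [imp_iff_not_or] using! DefP.or L (fun v => ¬ P v) Q

instance DefP.eq (s t : (α → M) → M) [hs : DefF L s] [ht : DefF L t] :
    DefP L (fun v => s v = t v) :=
  ⟨hs.out.ofPred_eq ht.out⟩

instance (priority := 900) DefP.exTuple [Finite ι] (P : (α → M) → (ι → M) → Prop)
    [h : DefP L fun w : α ⊕ ι → M => P (fun a => w (Sum.inl a)) (fun i => w (Sum.inr i))] :
    DefP L (fun v => ∃ y : ι → M, P v y) :=
  ⟨Set.Definable.exists_of_finite h.out⟩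

instance (priority := 900) DefP.allTuple [Finite ι] (P : (α → M) → (ι → M) → Prop)
    [h : DefP L fun w : α ⊕ ι → M => P (fun a => w (Sum.inl a)) (fun i => w (Sum.inr i))] :
    DefP L (fun v => ∀ y : ι → M, P v y) :=
  ⟨Set.Definable.forall_of_finite h.out⟩

instance DefP.ex (P : (α → M) → M → Prop)
    [h : DefP L fun w : α ⊕ Unit → M => P (fun a => w (Sum.inl a)) (w (Sum.inr ()))] :
    DefP L (fun v => ∃ y : M, P v y) := by
  have := DefP.exTuple L (ι := Unit) (fun v y => P v (y ()))
  refine ⟨?_⟩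
  convert! this.out using 3
  exact ⟨fun ⟨y, hy⟩ => ⟨fun _ => y, hy⟩, fun ⟨y, hy⟩ => ⟨y (), hy⟩⟩

instance DefP.all (P : (α → M) → M → Prop)
    [h : DefP L fun w : α ⊕ Unit → M => P (fun a => w (Sum.inl a)) (w (Sum.inr ()))] :
    DefP L (fun v => ∀ y : M, P v y) := by
  have := DefP.allTuple L (ι := Unit) (fun v y => P v (y ()))
  refine ⟨?_⟩
  convert! this.out using 3
  exact ⟨fun h y => h _, fun h y => h fun _ => y⟩

instance (priority := 800) DefP.allIndex [Finite ι] (P : (α → M) → ι → Prop)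
    [h : ∀ i, DefP L fun v => P v i] : DefP L (fun v => ∀ i, P v i) := by
  refine ⟨?_⟩
  have := Set.definable_iInter_of_finite fun i => (h i).out
  convert! this using 1
  ext; simp

instance (priority := 800) DefP.exIndex [Finite ι] (P : (α → M) → ι → Prop)
    [h : ∀ i, DefP L fun v => P v i] : DefP L (fun v => ∃ i, P v i) := by
  refine ⟨?_⟩
  have := Set.definable_iUnion_of_finite fun i => (h i).out
  convert! this using 1
  ext; simp

instance DefP.lt [L.IsOrdered] [LinearOrder M] [L.OrderedStructure M] (s t : (α → M) → M)
    [DefF L s] [DefF L t] : DefP L (fun v => s v < t v) := by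
  have : Def2 L (fun x y : M => x < y) := by
    refine ⟨?_⟩
    rw [Def, Set.definable_iff_exists_formula_sum]
    refine ⟨(FirstOrder.Language.Term.lt (n := 0) (FirstOrder.Language.Term.var (Sum.inl (Sum.inr 0)))
      (FirstOrder.Language.Term.var (Sum.inl (Sum.inr 1)))), ?_⟩
    ext v
    simp [FirstOrder.Language.Formula.Realize]
  exact DefP.comp2 L (fun x y : M => x < y) s t

instance DefP.le [L.IsOrdered] [LinearOrder M] [L.OrderedStructure M] (s t : (α → M) → M)
    [DefF L s] [DefF L t] : DefP L (fun v => s v ≤ t v) := by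
  simpa only [not_lt] using! DefP.not L (fun v => t v < s v)

end Predicates

end Definability

/-! ### One variable: germs, isolated points, monotone families. -/

section OneVariable

variable {L : FirstOrder.Language.{u, v}} {M : Type w} [LinearOrder M] [L.Structure M]

/-- The subset of `M` given by `P` contains a nonempty open interval. -/
def HasIoo (P : M → Prop) : Prop := ∃ u v, u < v ∧ ∀ t, u < t → t < v → P t

theorem HasIoo.mono {P Q : M → Prop} (h : HasIoo P) (hPQ : ∀ t, P t → Q t) : HasIoo Q := by
  obtain ⟨u, v, huv, h⟩ := h
  exact ⟨u, v, huv, fun t h1 h2 => hPQ t (h t h1 h2)⟩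

instance DefP.hasIoo [L.IsOrdered] [L.OrderedStructure M] {α : Type} [Finite α] (P : (α → M) → M → Prop)
    [h : DefP L fun w : α ⊕ Unit → M => P (fun a => w (Sum.inl a)) (w (Sum.inr ()))] :
    DefP L (fun v => HasIoo (P v)) := by
  -- Substitution specialised to this `P` lets instance search insert definable terms into it; the
  -- same device recurs below.
  have hP := fun (β : Type) s t => @DefP.compT L M _ β α _ P h s t
  unfold HasIoo
  infer_instance

/-- The filter `l` decides the predicate `p`. -/
def Decided (l : Filter M) (p : M → Prop) : Prop := (∀ᶠ t in l, p t) ∨ ∀ᶠ t in l, ¬ p t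

theorem Decided.or {l : Filter M} {p q : M → Prop} (hp : Decided l p) (hq : Decided l q) :
    Decided l (fun t => p t ∨ q t) := by
  rcases hp with hp | hp
  · exact Or.inl (hp.mono fun _ => Or.inl)
  · rcases hq with hq | hq
    · exact Or.inl (hq.mono fun _ => Or.inr)
    · exact Or.inr ((hp.and hq).mono fun _ h => not_or.2 h)

theorem Decided.and {l : Filter M} {p q : M → Prop} (hp : Decided l p) (hq : Decided l q) :
    Decided l (fun t => p t ∧ q t) := by
  rcases hp with hp | hp
  · rcases hq with hq | hq
    · exact Or.inl (hp.and hq)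
    · exact Or.inr (hq.mono fun _ h h' => h h'.2)
  · exact Or.inr (hp.mono fun _ h h' => h h'.1)

theorem Decided.not {l : Filter M} {p : M → Prop} (hp : Decided l p) :
    Decided l (fun t => ¬ p t) := by
  rcases hp with hp | hp
  · exact Or.inr (hp.mono fun _ h => not_not.2 h)
  · exact Or.inl hp

theorem Decided.exists_mem {β : Type*} {l : Filter M} (S : Finset β) (p : β → M → Prop)
    (h : ∀ b, Decided l (p b)) : Decided l (fun t => ∃ b ∈ S, p b t) := by
  classical
  induction S using Finset.induction_on with
  | empty => exact Or.inr (Eventually.of_forall fun _ => by simp)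
  | insert d S _ ih =>
    simp only [Finset.mem_insert, exists_eq_or_imp]
    exact (h d).or ih

section Topology

variable [TopologicalSpace M] [OrderTopology M]

/-- Near `a` the predicate is a finite Boolean combination of comparisons with fixed points, and
decided predicates are closed under such combinations. -/
theorem decided_of_le_nhds {l : Filter M} {a : M} (hloc : LocallyOMinimal L M) (hl : l ≤ 𝓝 a)
    (h1 : ∀ c, Decided l (· < c)) (h2 : ∀ c, Decided l (c < ·)) (P : M → Prop)
    [hP : Def1 L P] : Decided l P := by
  obtain ⟨b, c, hbc, S, I, hX⟩ := hloc {t | P t} hP.out a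
  have hmem : ∀ᶠ t in l, t ∈ Set.Ioo b c := hl (Ioo_mem_nhds hbc.1 hbc.2)
  have hd : Decided l (fun t => (∃ d ∈ S, ¬ t < d ∧ ¬ d < t) ∨ ∃ p ∈ I, p.1 < t ∧ t < p.2) :=
    (Decided.exists_mem S _ fun d => ((h1 d).not.and (h2 d).not)).or
      (Decided.exists_mem I _ fun p => (h2 p.1).and (h1 p.2))
  have key : ∀ t ∈ Set.Ioo b c,
      (P t ↔ ((∃ d ∈ S, ¬ t < d ∧ ¬ d < t) ∨ ∃ p ∈ I, p.1 < t ∧ t < p.2)) := by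
    intro t ht
    have : t ∈ {t | P t} ∩ Set.Ioo b c ↔ t ∈ (S : Set M) ∪ ⋃ p ∈ I, Set.Ioo p.1 p.2 := by rw [hX]
    have h3 : (∃ d ∈ S, ¬ t < d ∧ ¬ d < t) ↔ t ∈ S := by
      constructor
      · rintro ⟨d, hd, h, h'⟩
        rwa [le_antisymm (not_lt.1 h') (not_lt.1 h)]
      · exact fun h => ⟨t, h, lt_irrefl _, lt_irrefl _⟩
    rw [h3]
    simpa only [Set.mem_inter_iff, Set.mem_union, Set.mem_iUnion, Set.mem_Ioo, exists_prop, ht.1,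
      ht.2, and_self, and_true, Finset.mem_coe] using! this
  rcases hd with hd | hd
  · exact Or.inl ((hmem.and hd).mono fun t ht => (key t ht.1).2 ht.2)
  · exact Or.inr ((hmem.and hd).mono fun t ht h => ht.2 ((key t ht.1).1 h))

variable [DenselyOrdered M] [NoMinOrder M] [NoMaxOrder M]

theorem exists_right_germ (hloc : LocallyOMinimal L M) (P : M → Prop) [Def1 L P] (a : M) :
    (∃ s, a < s ∧ ∀ t, a < t → t < s → P t) ∨ ∃ s, a < s ∧ ∀ t, a < t → t < s → ¬ P t := by
  have hev : ∀ {p : M → Prop}, (∀ᶠ t in 𝓝[>] a, p t) → ∃ s, a < s ∧ ∀ t, a < t → t < s → p t := by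
    intro p hp
    obtain ⟨s, hs, h⟩ := (mem_nhdsGT_iff_exists_Ioo_subset).1 hp
    exact ⟨s, hs, fun t h1 h2 => h ⟨h1, h2⟩⟩
  have := decided_of_le_nhds (L := L) (l := 𝓝[>] a) hloc nhdsWithin_le_nhds (fun c => ?_) (fun c => ?_) P
  · exact this.imp hev hev
  · rcases lt_or_ge a c with h | h
    · exact Or.inl (mem_nhdsWithin_of_mem_nhds (Iio_mem_nhds h))
    · exact Or.inr (mem_of_superset self_mem_nhdsWithin fun t ht => not_lt.2 (h.trans (le_of_lt ht)))
  · rcases lt_or_ge a c with h | h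
    · exact Or.inr (mem_of_superset (mem_nhdsWithin_of_mem_nhds (Iio_mem_nhds h))
        fun t ht => not_lt.2 (le_of_lt ht))
    · exact Or.inl (mem_of_superset self_mem_nhdsWithin fun t ht => lt_of_le_of_lt h ht)

theorem exists_left_germ (hloc : LocallyOMinimal L M) (P : M → Prop) [Def1 L P] (a : M) :
    (∃ s, s < a ∧ ∀ t, s < t → t < a → P t) ∨ ∃ s, s < a ∧ ∀ t, s < t → t < a → ¬ P t := by
  have hev : ∀ {p : M → Prop}, (∀ᶠ t in 𝓝[<] a, p t) → ∃ s, s < a ∧ ∀ t, s < t → t < a → p t := by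
    intro p hp
    obtain ⟨s, hs, h⟩ := (mem_nhdsLT_iff_exists_Ioo_subset).1 hp
    exact ⟨s, hs, fun t h1 h2 => h ⟨h1, h2⟩⟩
  have := decided_of_le_nhds (L := L) (l := 𝓝[<] a) hloc nhdsWithin_le_nhds (fun c => ?_) (fun c => ?_) P
  · exact this.imp hev hev
  · rcases lt_or_ge c a with h | h
    · exact Or.inr (mem_of_superset (mem_nhdsWithin_of_mem_nhds (Ioi_mem_nhds h))
        fun t ht => not_lt.2 (le_of_lt ht))
    · exact Or.inl (mem_of_superset self_mem_nhdsWithin fun t ht => lt_of_lt_of_le ht h)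
  · rcases lt_or_ge c a with h | h
    · exact Or.inl (mem_nhdsWithin_of_mem_nhds (Ioi_mem_nhds h))
    · exact Or.inr (mem_of_superset self_mem_nhdsWithin fun t ht => not_lt.2 ((le_of_lt ht).trans h))

/-- Neither one-sided germ at `a` can be positive. As `a` is arbitrary, a definable set without an
interval is closed and discrete. -/
theorem exists_isolating (hloc : LocallyOMinimal L M) {P : M → Prop} [Def1 L P] (h : ¬ HasIoo P)
    (a : M) : ∃ b c, b < a ∧ a < c ∧ ∀ t, b < t → t < c → P t → t = a := by
  rcases exists_right_germ hloc P a with ⟨c, hc, h1⟩ | ⟨c, hc, h1⟩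
  · exact absurd ⟨a, c, hc, h1⟩ h
  rcases exists_left_germ hloc P a with ⟨b, hb, h2⟩ | ⟨b, hb, h2⟩
  · exact absurd ⟨b, a, hb, h2⟩ h
  refine ⟨b, c, hb, hc, fun t hbt htc hPt => ?_⟩
  rcases lt_trichotomy t a with h | h | h
  · exact absurd hPt (h2 t hbt h)
  · exact h
  · exact absurd hPt (h1 t h htc)

theorem HasIoo.or (hloc : LocallyOMinimal L M) {P Q : M → Prop} [Def1 L P]
    (h : HasIoo fun t => P t ∨ Q t) : HasIoo P ∨ HasIoo Q := by
  obtain ⟨u, v, huv, h⟩ := h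
  obtain ⟨a, hua, hav⟩ := exists_between huv
  rcases exists_right_germ hloc P a with ⟨s, hs, h1⟩ | ⟨s, hs, h1⟩
  · exact Or.inl ⟨a, s, hs, h1⟩
  · refine Or.inr ⟨a, min s v, lt_min hs hav, fun t h2 h3 => ?_⟩
    exact (h t (hua.trans h2) (h3.trans_le (min_le_right _ _))).resolve_left
      (h1 t h2 (h3.trans_le (min_le_left _ _)))

theorem HasIoo.exists_subinterval {P : M → Prop} {p q : M}
    (h : HasIoo fun t => p < t ∧ t < q ∧ P t) :
    ∃ u v, p ≤ u ∧ u < v ∧ v ≤ q ∧ ∀ t, u < t → t < v → P t := by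
  obtain ⟨u, v, huv, h⟩ := h
  refine ⟨u, v, ?_, huv, ?_, fun t h1 h2 => (h t h1 h2).2.2⟩
  · by_contra hlt
    obtain ⟨t, ht1, ht2⟩ := exists_between (lt_min (not_le.1 hlt) huv)
    exact lt_asymm (h t ht1 (ht2.trans_le (min_le_right _ _))).1 (ht2.trans_le (min_le_left _ _))
  · by_contra hlt
    obtain ⟨t, ht1, ht2⟩ := exists_between (max_lt (not_le.1 hlt) huv)
    exact lt_asymm (h t ((le_max_right _ _).trans_lt ht1) ht2).2.1 ((le_max_left _ _).trans_lt ht1)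

variable (hloc : LocallyOMinimal L M) (hdc : DefinablyComplete L M)
include hloc hdc

/-- The infimum is approached by points of the set, yet has a neighbourhood containing no point of
the set other than itself; so it belongs to the set. -/
theorem exists_least {P : M → Prop} [hP : Def1 L P] (hne : ∃ t, P t) (lo : M)
    (hlo : ∀ t, P t → lo ≤ t) (h : ¬ HasIoo P) : ∃ a, P a ∧ ∀ t, P t → a ≤ t := by
  obtain ⟨a, ha⟩ := (hdc {t | P t} hP.out hne).2 ⟨lo, fun t ht => hlo t ht⟩
  refine ⟨a, ?_, fun t ht => ha.1 ht⟩
  obtain ⟨b, c, hb, hc, hiso⟩ := exists_isolating hloc h a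
  obtain ⟨t, ht, h1, h2⟩ := ha.exists_between hc
  rwa [← hiso t (hb.trans_le h1) h2 ht]

variable [L.IsOrdered] [L.OrderedStructure M]

/-- The initial segments `D x` are totally ordered by inclusion. Without a common bound they cannot
increase along an interval, so just to the right of any `x₀` each `D z` is strictly exceeded by some
earlier `D x'`. For fixed `z`, the set of such `x'` contains no interval and hence has a least
element, but that element is itself exceeded by an earlier one. -/
theorem exists_common_bound {D : M → M → Prop} [hD : Def2 L D]
    (hlow : ∀ x s s', s' ≤ s → D x s → D x s') {p q : M} (hpq : p < q)
    (h : ∀ x, p < x → x < q → ∃ s, x < s ∧ D x s) :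
    ∃ y, HasIoo fun x => p < x ∧ x < q ∧ x < y ∧ D x y := by
  have hD' := fun (α : Type) s t => @DefP.comp2 L M _ α D hD s t
  by_contra! hV
  obtain ⟨x₀, hpx, hxq⟩ := exists_between hpq
  have htot : ∀ x x', (∃ s, D x s ∧ ¬ D x' s) → ∀ s, D x' s → D x s := by
    rintro x x' ⟨s, h1, h2⟩ t ht
    rcases le_total t s with hts | hts
    · exact hlow _ _ _ hts h1
    · exact absurd (hlow _ _ _ hts ht) h2
  have hC : ¬ HasIoo fun z => x₀ < z ∧ z < q ∧ ∀ x', x₀ < x' → x' < z → ∀ s, D x' s → D z s := by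
    intro hC
    obtain ⟨c, d, hxc, hcd, hdq, hC⟩ := hC.exists_subinterval
    obtain ⟨x₁, hc1, h1d⟩ := exists_between hcd
    obtain ⟨s, h1s, hs⟩ := h x₁ (hpx.trans (hxc.trans_lt hc1)) (h1d.trans_le hdq)
    obtain ⟨y, h1y, hy⟩ := exists_between (lt_min h1s h1d)
    refine hV y ⟨x₁, y, h1y, fun x h1x hxy => ?_⟩
    have hxd : x < d := hxy.trans (hy.trans_le (min_le_right _ _))
    exact ⟨hpx.trans (hxc.trans_lt (hc1.trans h1x)), hxd.trans_le hdq, hxy,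
      hC x (hc1.trans h1x) hxd x₁ (hxc.trans_lt hc1) h1x y
        (hlow _ _ _ (hy.trans_le (min_le_left _ _)).le hs)⟩
  obtain ⟨b, w, hb, hw, hiso⟩ := exists_isolating hloc hC x₀
  have hnot : ∀ z, x₀ < z → z < min w q → ∃ x', x₀ < x' ∧ x' < z ∧ ∃ s, D x' s ∧ ¬ D z s := by
    intro z h1 h2
    by_contra! hcon
    exact h1.ne' (hiso z (hb.trans h1) (h2.trans_le (min_le_left _ _))
      ⟨h1, h2.trans_le (min_le_right _ _), hcon⟩)
  obtain ⟨z, hz1, hz2⟩ := exists_between (lt_min hw hxq)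
  have hS : ¬ HasIoo fun x' => x₀ < x' ∧ x' < z ∧ ∃ s, D x' s ∧ ¬ D z s := by
    intro hS
    refine hV z (hS.mono fun t ht => ?_)
    obtain ⟨h1, h2, h3⟩ := ht
    have hzq := hz2.trans_le (min_le_right _ _)
    obtain ⟨s, hzs, hs⟩ := h z (hpx.trans hz1) hzq
    exact ⟨hpx.trans h1, h2.trans hzq, h2, htot _ _ h3 z (hlow _ _ _ hzs.le hs)⟩
  obtain ⟨x₁, ⟨h1, h2, s, hs1, hs2⟩, hleast⟩ :=
    exists_least hloc hdc (hnot z hz1 hz2) x₀ (fun t ht => ht.1.le) hS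
  obtain ⟨x₂, h3, h4, h5⟩ := hnot x₁ h1 (h2.trans hz2)
  exact absurd (hleast x₂ ⟨h3, h4.trans h2, s, htot _ _ h5 s hs1, hs2⟩) (not_le.2 h4)

/-- A definable family of initial segments is monotone or antitone on some subinterval. -/
theorem exists_monotone_subinterval {F : M → M → Prop} [hF : Def2 L F]
    (hlow : ∀ x s s', s' ≤ s → F x s → F x s') {p q : M} (hpq : p < q) :
    ∃ p' q', p ≤ p' ∧ p' < q' ∧ q' ≤ q ∧
      ((∀ x x', p' < x → x < x' → x' < q' → ∀ t, F x t → F x' t) ∨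
        ∀ x x', p' < x → x < x' → x' < q' → ∀ t, F x' t → F x t) := by
  have hF' := fun (α : Type) s t => @DefP.comp2 L M _ α F hF s t
  have htot : ∀ x x', ¬ (∀ s, F x s → F x' s) → ∀ s, F x' s → F x s := by
    intro x x' hn t ht
    push Not at hn
    obtain ⟨s, h1, h2⟩ := hn
    rcases le_total t s with hts | hts
    · exact hlow _ _ _ hts h1
    · exact absurd (hlow _ _ _ hts ht) h2
  -- Each `x` compares in a constant direction with the points just to its right. One direction
  -- prevails on an interval, and `exists_common_bound` makes the range of comparison uniform.
  have hsplit : HasIoo fun x =>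
      (p < x ∧ x < q ∧ ∃ s, x < s ∧ ∀ x', x < x' → x' < s → ∀ t, F x t → F x' t) ∨
      (p < x ∧ x < q ∧ ∃ s, x < s ∧ ∀ x', x < x' → x' < s → ∀ t, F x' t → F x t) := by
    refine ⟨p, q, hpq, fun x h1 h2 => ?_⟩
    rcases exists_right_germ hloc (fun x' => ∀ t, F x t → F x' t) x with ⟨s, hs, h⟩ | ⟨s, hs, h⟩
    · exact Or.inl ⟨h1, h2, s, hs, h⟩
    · exact Or.inr ⟨h1, h2, s, hs, fun x' h3 h4 => htot _ _ (h x' h3 h4)⟩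
  rcases hsplit.or hloc with h | h
  · obtain ⟨u, v, hpu, huv, hvq, h⟩ := h.exists_subinterval
    obtain ⟨y, hy⟩ := exists_common_bound hloc hdc
      (D := fun x s => ∀ x', x < x' → x' < s → ∀ t, F x t → F x' t)
      (fun x s s' hs hx x' h1 h2 => hx x' h1 (h2.trans_le hs)) huv h
    obtain ⟨p', q', h1, h2, h3, h4⟩ := hy.exists_subinterval
    refine ⟨p', q', hpu.trans h1, h2, h3.trans hvq, Or.inl fun x x' hx hxx hx' => ?_⟩
    exact (h4 x hx (hxx.trans hx')).2 x' hxx (h4 x' (hx.trans hxx) hx').1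
  · obtain ⟨u, v, hpu, huv, hvq, h⟩ := h.exists_subinterval
    obtain ⟨y, hy⟩ := exists_common_bound hloc hdc
      (D := fun x s => ∀ x', x < x' → x' < s → ∀ t, F x' t → F x t)
      (fun x s s' hs hx x' h1 h2 => hx x' h1 (h2.trans_le hs)) huv h
    obtain ⟨p', q', h1, h2, h3, h4⟩ := hy.exists_subinterval
    refine ⟨p', q', hpu.trans h1, h2, h3.trans hvq, Or.inr fun x x' hx hxx hx' => ?_⟩
    exact (h4 x hx (hxx.trans hx')).2 x' hxx (h4 x' (hx.trans hxx) hx').1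

/-- There is no bounded definable family of convex sets with at least two points each which is
strictly ordered along a definable total relation without first element. -/
theorem false_of_strictly_ordered_family {J : M → Prop} [hJ : Def1 L J] {A r : M → M → Prop}
    [hA : Def2 L A] (hne : ∃ x, J x)
    (hpred : ∀ x, J x → ∃ x', J x' ∧ r x' x)
    (htot : ∀ x x', J x → J x' → x = x' ∨ r x x' ∨ r x' x)
    (hr : ∀ x x', J x → J x' → r x x' → ∀ c c', A x c → A x' c' → c < c')
    (htwo : ∀ x, J x → ∃ c c', c < c' ∧ A x c ∧ A x c') (lo hi : M)
    (hbd : ∀ x, J x → ∀ c, A x c → lo < c ∧ c < hi) : False := by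
  have hJ' := fun (α : Type) t => @DefP.comp1 L M _ α J hJ t
  have hA' := fun (α : Type) s t => @DefP.comp2 L M _ α A hA s t
  -- The suprema of the sets `A x`.
  let T : M → Prop := fun b => ∃ x, J x ∧ (∀ c, A x c → c ≤ b) ∧ ∀ b', (∀ c, A x c → c ≤ b') → b ≤ b'
  have hlub : ∀ x, J x → ∃ b, (∀ c, A x c → c ≤ b) ∧ ∀ b', (∀ c, A x c → c ≤ b') → b ≤ b' := by
    intro x hx
    obtain ⟨c, -, -, hc, -⟩ := htwo x hx
    have : Def1 L (fun c => A x c) := inferInstance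
    obtain ⟨b, hb⟩ := (hdc {c | A x c} this.out ⟨c, hc⟩).1 ⟨hi, fun c hc => (hbd x hx c hc).2.le⟩
    exact ⟨b, fun c hc => hb.1 hc, fun b' h => hb.2 fun c hc => h c hc⟩
  -- If suprema filled an interval, one would fall strictly between two points `c < c'` of a single
  -- `A x₁`. A set before `A x₁` has supremum at most `c`, and every other one has supremum at least
  -- `c'`.
  have hT : ¬ HasIoo T := by
    rintro ⟨u, v, huv, hT⟩
    obtain ⟨b₁, hub, hbv⟩ := exists_between huv
    obtain ⟨b₀, hu0, h01⟩ := exists_between hub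
    obtain ⟨x₁, hx1, hb1, hb1'⟩ := hT b₁ hub hbv
    obtain ⟨x₀, hx0, hb0, hb0'⟩ := hT b₀ hu0 (h01.trans hbv)
    obtain ⟨c, c', hcc, hc, hc'⟩ := htwo x₁ hx1
    have h0c : b₀ ≤ c := by
      rcases htot x₀ x₁ hx0 hx1 with h | h | h
      · subst h; exact absurd (hb1' b₀ hb0) (not_le.2 h01)
      · exact hb0' c fun d hd => (hr _ _ hx0 hx1 h d c hd hc).le
      · obtain ⟨d, -, -, hd, -⟩ := htwo x₀ hx0
        exact absurd ((hb1' d fun e he => (hr _ _ hx1 hx0 h e d he hd).le).trans (hb0 d hd))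
          (not_le.2 h01)
    obtain ⟨d, hcd, hdc'⟩ := exists_between hcc
    obtain ⟨x₂, hx2, hd, hd'⟩ := hT d (hu0.trans (h0c.trans_lt hcd))
      ((hdc'.trans_le (hb1 c' hc')).trans hbv)
    rcases htot x₂ x₁ hx2 hx1 with h | h | h
    · subst h; exact absurd (hd c' hc') (not_le.2 hdc')
    · exact absurd (hd' c fun e he => (hr _ _ hx2 hx1 h e c he hc).le) (not_le.2 hcd)
    · obtain ⟨e, -, -, he, -⟩ := htwo x₂ hx2
      exact absurd ((hr _ _ hx1 hx2 h c' e hc' he).trans_le (hd e he)) (not_lt.2 hdc'.le)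
  obtain ⟨x, hx⟩ := hne
  obtain ⟨b, hb⟩ := hlub x hx
  have hTdef : Def1 L T := by
    change Def1 L fun b => ∃ x, J x ∧ (∀ c, A x c → c ≤ b) ∧ ∀ b', (∀ c, A x c → c ≤ b') → b ≤ b'
    infer_instance
  have hlo : ∀ t, T t → lo ≤ t := by
    rintro t ⟨x, hx, ht, -⟩
    obtain ⟨c, -, -, hc, -⟩ := htwo x hx
    exact (hbd x hx c hc).1.le.trans (ht c hc)
  -- The least supremum is undercut by that of a predecessor, because `A x` has two points.
  obtain ⟨b, ⟨x, hx, hb, -⟩, hleast⟩ := exists_least hloc hdc ⟨b, x, hx, hb⟩ lo hlo hT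
  obtain ⟨x', hx', hxx⟩ := hpred x hx
  obtain ⟨b', hb'⟩ := hlub x' hx'
  obtain ⟨c, c', hcc, hc, hc'⟩ := htwo x hx
  have h1 : b' ≤ c := hb'.2 c fun d hd => (hr _ _ hx' hx hxx d c hd hc).le
  exact absurd (((hleast b' ⟨x', hx', hb'⟩).trans h1).trans_lt hcc) (not_lt.2 (hb c' hc'))

end Topology

end OneVariable

/-! ### Two variables: common points of sections and exchange of quantifiers. -/

section TwoVariables

variable {L : FirstOrder.Language.{u, v}} {M : Type w} [LinearOrder M] [L.Structure M]
  [TopologicalSpace M] [OrderTopology M] [DenselyOrdered M] [NoMinOrder M] [NoMaxOrder M]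
  [L.IsOrdered] [L.OrderedStructure M]
  (hloc : LocallyOMinimal L M) (hdc : DefinablyComplete L M)
include hloc hdc

/-- If `F x ⊆ G x` are definable families of initial segments of `M`, with at least two points in
each difference, then some point belongs to `G x \ F x` for all `x` in an interval. -/
theorem exists_hasIoo_sdiff {F G : M → M → Prop} [hF : Def2 L F] [hG : Def2 L G]
    (hFlow : ∀ x s s', s' ≤ s → F x s → F x s') (hGlow : ∀ x s s', s' ≤ s → G x s → G x s')
    {p q : M} (hpq : p < q)
    (htwo : ∀ x, p < x → x < q → ∃ c c', c < c' ∧ ¬ F x c ∧ G x c') :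
    ∃ c, HasIoo fun x => p < x ∧ x < q ∧ G x c ∧ ¬ F x c := by
  have hF' := fun (α : Type) s t => @DefP.comp2 L M _ α F hF s t
  have hG' := fun (α : Type) s t => @DefP.comp2 L M _ α G hG s t
  obtain ⟨p₁, q₁, hp1, h1, hq1, hmF⟩ := exists_monotone_subinterval hloc hdc hFlow hpq
  obtain ⟨p₂, q₂, hp2, h2, hq2, hmG⟩ := exists_monotone_subinterval hloc hdc hGlow h1
  by_contra! hcon
  have hpp := hp1.trans hp2
  have hqq := hq2.trans hq1
  have hA : ∀ x, p₂ < x → x < q₂ → ∃ c c', c < c' ∧ (G x c ∧ ¬ F x c) ∧ G x c' ∧ ¬ F x c' := by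
    intro x hx hx'
    obtain ⟨c, c', h, hc, hc'⟩ := htwo x (hpp.trans_lt hx) (hx'.trans_le hqq)
    exact ⟨c, c', h, ⟨hGlow _ _ _ h.le hc', hc⟩, hc', fun hf => hc (hFlow _ _ _ h.le hf)⟩
  have hno : ∀ c u v, p₂ ≤ u → u < v → v ≤ q₂ → ∃ x, u < x ∧ x < v ∧ ¬ (G x c ∧ ¬ F x c) := by
    intro c u v hu huv hv
    by_contra! hx
    exact hcon c ⟨u, v, huv, fun x h1 h2 =>
      ⟨hpp.trans_lt (hu.trans_lt h1), h2.trans_le (hv.trans hqq), hx x h1 h2⟩⟩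
  obtain ⟨x₁, hp₂1, h1q₂⟩ := exists_between h2
  obtain ⟨x₀, hp₂0, h01⟩ := exists_between hp₂1
  have h0q₂ := h01.trans h1q₂
  have hcomp : ∀ {x c c'}, ¬ F x c → F x c' → c' < c :=
    fun {x c c'} h h' => lt_of_not_ge fun hle => h (hFlow _ _ _ hle h')
  have hcomp' : ∀ {x c c'}, ¬ G x c → G x c' → c' < c :=
    fun {x c c'} h h' => lt_of_not_ge fun hle => h (hGlow _ _ _ hle h')
  have hmF : (∀ x x', p₂ < x → x < x' → x' < q₂ → ∀ t, F x t → F x' t) ∨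
      ∀ x x', p₂ < x → x < x' → x' < q₂ → ∀ t, F x' t → F x t :=
    hmF.imp (fun h x x' h3 h4 h5 => h x x' (hp2.trans_lt h3) h4 (h5.trans_le hq2))
      fun h x x' h3 h4 h5 => h x x' (hp2.trans_lt h3) h4 (h5.trans_le hq2)
  have hJdef : Def1 L fun x => x₀ < x ∧ x < x₁ := inferInstance
  have hAdef : Def2 L fun x c => G x c ∧ ¬ F x c := inferInstance
  obtain ⟨lo, hi₀, -, ⟨hlo1, hlo2⟩, -, -⟩ := hA x₀ hp₂0 h0q₂
  obtain ⟨lo', hi₁, -, ⟨hlo1', hlo2'⟩, -, -⟩ := hA x₁ hp₂1 h1q₂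
  have htwoJ : ∀ x, x₀ < x ∧ x < x₁ → ∃ c c', c < c' ∧ (G x c ∧ ¬ F x c) ∧ G x c' ∧ ¬ F x c' :=
    fun x hx => hA x (hp₂0.trans hx.1) (hx.2.trans h1q₂)
  rcases hmF with hmF | hmF <;> rcases hmG with hmG | hmG
  -- Both families increase. If `c` were outside `F x'`, it would lie in every difference between
  -- `x` and `x'`, contrary to assumption; hence the differences are strictly ordered.
  · have hord : ∀ x x', p₂ < x → x < x' → x' < q₂ → ∀ c c', (G x c ∧ ¬ F x c) →
        (G x' c' ∧ ¬ F x' c') → c < c' := by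
      intro x x' h3 h4 h5 c c' hc hc'
      refine hcomp hc'.2 ?_
      by_contra hFc
      obtain ⟨y, hxy, hyx, hy⟩ := hno c x x' h3.le h4 h5.le
      exact hy ⟨hmG x y h3 hxy (hyx.trans h5) c hc.1,
        fun h => hFc (hmF y x' (h3.trans hxy) hyx h5 c h)⟩
    refine false_of_strictly_ordered_family hloc hdc (J := fun x => x₀ < x ∧ x < x₁)
      (A := fun x c => G x c ∧ ¬ F x c) (r := fun x x' => x < x') (exists_between h01) ?_ ?_ ?_
      htwoJ lo lo' ?_
    · intro x hx
      obtain ⟨x', h3, h4⟩ := exists_between hx.1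
      exact ⟨x', ⟨h3, h4.trans hx.2⟩, h4⟩
    · intro x x' _ _
      rcases lt_trichotomy x x' with h | h | h <;> tauto
    · intro x x' hx hx' hxx
      exact hord x x' (hp₂0.trans hx.1) hxx (hx'.2.trans h1q₂)
    · intro x hx c hc
      exact ⟨hord x₀ x hp₂0 hx.1 (hx.2.trans h1q₂) _ _ ⟨hlo1, hlo2⟩ hc,
        hord x x₁ (hp₂0.trans hx.1) hx.2 h1q₂ _ _ hc ⟨hlo1', hlo2'⟩⟩
  -- The differences shrink as `x` grows, so `lo` lies in all the earlier ones.
  · obtain ⟨x, h3, h4, h5⟩ := hno lo p₂ x₀ le_rfl hp₂0 h0q₂.le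
    exact h5 ⟨hmG x x₀ h3 h4 h0q₂ _ hlo1, fun h => hlo2 (hmF x x₀ h3 h4 h0q₂ _ h)⟩
  -- The differences grow with `x`, so `lo` lies in all the later ones.
  · obtain ⟨x, h3, h4, h5⟩ := hno lo x₀ q₂ hp₂0.le h0q₂ le_rfl
    exact h5 ⟨hmG x₀ x hp₂0 h3 h4 _ hlo1, fun h => hlo2 (hmF x₀ x hp₂0 h3 h4 _ h)⟩
  · have hord : ∀ x x', p₂ < x → x < x' → x' < q₂ → ∀ c c', (G x c ∧ ¬ F x c) →
        (G x' c' ∧ ¬ F x' c') → c' < c := by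
      intro x x' h3 h4 h5 c c' hc hc'
      refine hcomp' ?_ hc'.1
      intro hGc
      obtain ⟨y, hxy, hyx, hy⟩ := hno c x x' h3.le h4 h5.le
      exact hy ⟨hmG y x' (h3.trans hxy) hyx h5 c hGc,
        fun h => hc.2 (hmF x y h3 hxy (hyx.trans h5) c h)⟩
    refine false_of_strictly_ordered_family hloc hdc (J := fun x => x₀ < x ∧ x < x₁)
      (A := fun x c => G x c ∧ ¬ F x c) (r := fun x x' => x' < x) (exists_between h01) ?_ ?_ ?_
      htwoJ lo' lo ?_
    · intro x hx
      obtain ⟨x', h3, h4⟩ := exists_between hx.2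
      exact ⟨x', ⟨hx.1.trans h3, h4⟩, h3⟩
    · intro x x' _ _
      rcases lt_trichotomy x x' with h | h | h <;> tauto
    · intro x x' hx hx' hxx c c' hc hc'
      exact hord x' x (hp₂0.trans hx'.1) hxx (hx.2.trans h1q₂) _ _ hc' hc
    · intro x hx c hc
      exact ⟨hord x x₁ (hp₂0.trans hx.1) hx.2 h1q₂ _ _ hc ⟨hlo1', hlo2'⟩,
        hord x₀ x hp₂0 hx.1 (hx.2.trans h1q₂) _ _ ⟨hlo1, hlo2⟩ hc⟩

/-- After shrinking the interval of `x`, a fixed `p₀` has an interval of every `P x` above it. The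
first component of the interior of `P x` above `p₀` is then a difference of two initial segments, to
which `exists_hasIoo_sdiff` applies. -/
theorem exists_hasIoo_section {P : M → M → Prop} [hP : Def2 L P] {p q : M} (hpq : p < q)
    (h : ∀ x, p < x → x < q → HasIoo (P x)) :
    ∃ c, HasIoo fun x => p < x ∧ x < q ∧ P x c := by
  have hP' := fun (α : Type) s t => @DefP.comp2 L M _ α P hP s t
  have hne : ∀ E : M → M → Prop, (∀ x s s', s' ≤ s → E x s → E x s') → Def2 L E →
      (∀ x, p < x → x < q → ∃ s, E x s) → ∃ s p' q', p ≤ p' ∧ p' < q' ∧ q' ≤ q ∧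
        ∀ x, p' < x → x < q' → E x s := by
    intro E hlow hE hEne
    obtain ⟨p₁, q₁, h1, h2, h3, hm | hm⟩ := exists_monotone_subinterval hloc hdc hlow hpq
    all_goals
      obtain ⟨x₀, h4, h5⟩ := exists_between h2
      obtain ⟨s, hs⟩ := hEne x₀ (h1.trans_lt h4) (h5.trans_le h3)
    · exact ⟨s, x₀, q₁, h1.trans h4.le, h5, h3, fun x h6 h7 => hm x₀ x h4 h6 h7 s hs⟩
    · exact ⟨s, p₁, x₀, h1, h4, h5.le.trans h3, fun x h6 h7 => hm x x₀ h6 h7 h5 s hs⟩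
  obtain ⟨p₀, p₁, q₁, hp1, h1, hq1, hE⟩ := hne
    (fun x s => ∃ u v, s ≤ u ∧ u < v ∧ ∀ t, u < t → t < v → P x t)
    (by rintro x s s' hs ⟨u, v, h1, h2⟩; exact ⟨u, v, hs.trans h1, h2⟩) inferInstance
    (by intro x hx hx'; obtain ⟨u, v, h1, h2⟩ := h x hx hx'; exact ⟨u, u, v, le_rfl, h1, h2⟩)
  -- `I x` is the interior of `P x`. `F x` stops where that interior first appears above `p₀`, and
  -- `G x` continues through its first component.
  let I : M → M → Prop := fun x t => ∃ u v, u < t ∧ t < v ∧ ∀ t', u < t' → t' < v → P x t'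
  let F : M → M → Prop := fun x s => ∀ t, p₀ < t → t ≤ s → ¬ I x t
  let G : M → M → Prop := fun x s => ∀ t, p₀ < t → t ≤ s → I x t ∨ F x t
  have hIdef : Def2 L I := by
    change Def2 L fun x t => ∃ u v, u < t ∧ t < v ∧ ∀ t', u < t' → t' < v → P x t'
    infer_instance
  have hI' := fun (α : Type) s t => @DefP.comp2 L M _ α I hIdef s t
  have hFdef : Def2 L F := by
    change Def2 L fun x s => ∀ t, p₀ < t → t ≤ s → ¬ I x t
    infer_instance
  have hF' := fun (α : Type) s t => @DefP.comp2 L M _ α F hFdef s t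
  have hGdef : Def2 L G := by
    change Def2 L fun x s => ∀ t, p₀ < t → t ≤ s → I x t ∨ F x t
    infer_instance
  obtain ⟨c, hc⟩ := exists_hasIoo_sdiff hloc hdc (F := F) (G := G)
    (fun x s s' hs hx t h2 h3 => hx t h2 (h3.trans hs))
    (fun x s s' hs hx t h2 h3 => hx t h2 (h3.trans hs)) h1 (by
      intro x hx hx'
      obtain ⟨u, v, hpu, huv, hP⟩ := hE x hx hx'
      have hIuv : ∀ t, u < t → t < v → I x t := fun t h1 h2 => ⟨u, v, h1, h2, hP⟩
      obtain ⟨w, huw, hwv⟩ := exists_between huv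
      have hdef : Def1 L fun t => p₀ < t ∧ I x t := inferInstance
      obtain ⟨a, ha⟩ := (hdc {t | p₀ < t ∧ I x t} hdef.out ⟨w, hpu.trans_lt huw, hIuv w huw hwv⟩).2
        ⟨p₀, fun t ht => ht.1.le⟩
      have hpa : p₀ ≤ a := ha.2 fun t ht => ht.1.le
      have hbelow : ∀ t, p₀ < t → t < a → ¬ I x t := fun t h2 h3 h4 =>
        absurd (ha.1 ⟨h2, h4⟩) (not_le.2 h3)
      obtain ⟨s, has, hs⟩ : ∃ s, a < s ∧ ∀ t, a < t → t < s → I x t := by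
        rcases exists_right_germ hloc (fun t => I x t) a with h | ⟨s, has, hs⟩
        · exact h
        obtain ⟨t, ⟨hpt, htI⟩, hat, hts⟩ := ha.exists_between has
        obtain rfl : a = t := by
          by_contra hne
          exact hs t (lt_of_le_of_ne hat hne) hts htI
        obtain ⟨u, v, hu, hv, hP⟩ := htI
        exact ⟨v, hv, fun t h3 h4 => ⟨u, v, hu.trans h3, h4, hP⟩⟩
      obtain ⟨c', hac', hc's⟩ := exists_between has
      obtain ⟨c, hac, hcc'⟩ := exists_between hac'
      refine ⟨c, c', hcc', fun hF => hF c (hpa.trans_lt hac) le_rfl (hs c hac (hcc'.trans hc's)), ?_⟩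
      intro t hpt htc
      by_cases htI : I x t
      · exact Or.inl htI
      refine Or.inr fun t' hpt' ht't => ?_
      have hta : t ≤ a := by
        by_contra hat
        exact htI (hs t (not_le.1 hat) (htc.trans_lt hc's))
      rcases lt_or_eq_of_le ht't with h | h
      · exact hbelow t' hpt' (h.trans_le hta)
      · rwa [h])
  refine ⟨c, hc.mono fun x ⟨h2, h3, hG, hF⟩ =>
    ⟨hp1.trans_lt h2, h3.trans_le hq1, ?_⟩⟩
  have hpc : p₀ < c := by
    by_contra hcp
    exact hF fun t h4 h5 => absurd (h4.trans_le h5) hcp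
  obtain ⟨u, v, hu, hv, hP⟩ := (hG c hpc le_rfl).resolve_right hF
  exact hP c hu hv

/-- The quantifiers "for all elements of some interval" commute. -/
theorem HasIoo.swap {P : M → M → Prop} [hP : Def2 L P] (h : HasIoo fun x => HasIoo fun t => P x t) :
    HasIoo fun t => HasIoo fun x => P x t := by
  have hP' := fun (α : Type) s t => @DefP.comp2 L M _ α P hP s t
  obtain ⟨p, q, hpq, h⟩ := h
  obtain ⟨c, hc⟩ := exists_hasIoo_section hloc hdc
    (P := fun x t => ∃ u v, u < t ∧ t < v ∧ ∀ t', u < t' → t' < v → P x t') hpq (by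
      intro x h1 h2
      obtain ⟨u, v, huv, h⟩ := h x h1 h2
      exact ⟨u, v, huv, fun t h3 h4 => ⟨u, v, h3, h4, h⟩⟩)
  obtain ⟨p₁, q₁, hpq1, h⟩ := hc
  -- With `c` interior to every section, a second common point `c'` below it gives a common interval
  -- `(c', c)`.
  obtain ⟨c', p₂, q₂, hpq2, h'⟩ := exists_hasIoo_section hloc hdc
    (P := fun x t => t < c ∧ ∀ t', t < t' → t' < c → P x t') hpq1 (by
      intro x h1 h2
      obtain ⟨-, -, u, v, huc, hcv, h⟩ := h x h1 h2
      exact ⟨u, c, huc, fun t h3 h4 => ⟨h4, fun t' h5 h6 => h t' (h3.trans h5) (h6.trans hcv)⟩⟩)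
  obtain ⟨x, hx1, hx2⟩ := exists_between hpq2
  exact ⟨c', c, (h' x hx1 hx2).2.2.1, fun t h1 h2 => ⟨p₂, q₂, hpq2, fun x h3 h4 =>
    (h' x h3 h4).2.2.2 t h1 h2⟩⟩

end TwoVariables

/-! ### Open boxes in several coordinates and the Kuratowski–Ulam principle. -/

section Boxes

variable {L : FirstOrder.Language.{u, v}} {M : Type w} [LinearOrder M] {ι : Type}

/-- `y` lies in the open box with corners `a`, `b` in the coordinates from `I` and agrees with
`y₀` in the other coordinates. -/
def InBox (I : Finset ι) (a b y₀ y : ι → M) : Prop :=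
  (∀ j ∈ I, a j < y j ∧ y j < b j) ∧ ∀ j ∉ I, y j = y₀ j

/-- `P` holds on an open box in the coordinates from `I`, the others being those of `y₀`. -/
def HasBox (I : Finset ι) (P : (ι → M) → Prop) (y₀ : ι → M) : Prop :=
  ∃ a b : ι → M, (∀ j, a j < b j) ∧ ∀ y, InBox I a b y₀ y → P y

theorem HasBox.mono {I : Finset ι} {P Q : (ι → M) → Prop} {y₀ : ι → M} (h : HasBox I P y₀)
    (hPQ : ∀ y, P y → Q y) : HasBox I Q y₀ := by
  obtain ⟨a, b, hab, h⟩ := h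
  exact ⟨a, b, hab, fun y hy => hPQ y (h y hy)⟩

theorem InBox.exists [DenselyOrdered M] (I : Finset ι) {a b : ι → M} (hab : ∀ j, a j < b j)
    (y₀ : ι → M) : ∃ y, InBox I a b y₀ y := by
  classical
  choose c hc using fun j => exists_between (hab j)
  exact ⟨fun j => if j ∈ I then c j else y₀ j, fun j hj => by simpa [hj] using hc j,
    fun j hj => by simp [hj]⟩

theorem HasBox.exists [DenselyOrdered M] {I : Finset ι} {P : (ι → M) → Prop} {y₀ : ι → M}
    (h : HasBox I P y₀) : ∃ y, P y := by
  obtain ⟨a, b, hab, h⟩ := h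
  obtain ⟨y, hy⟩ := InBox.exists I hab y₀
  exact ⟨y, h y hy⟩

theorem hasBox_empty [NoMaxOrder M] {P : (ι → M) → Prop} {y₀ : ι → M} :
    HasBox ∅ P y₀ ↔ P y₀ := by
  constructor
  · rintro ⟨a, b, -, h⟩
    exact h y₀ ⟨by simp, by simp⟩
  · intro h
    choose b hb using fun j => exists_gt (y₀ j)
    refine ⟨y₀, b, hb, fun y hy => ?_⟩
    rwa [show y = y₀ from funext fun j => hy.2 j (by simp)]

variable [DecidableEq ι]

theorem HasBox.of_insert {I : Finset ι} {i : ι} (hi : i ∉ I) {P : (ι → M) → Prop} {y₀ : ι → M}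
    (h : HasBox (insert i I) P y₀) :
    HasBox I (fun y => HasIoo fun t => P (Function.update y i t)) y₀ := by
  obtain ⟨a, b, hab, h⟩ := h
  refine ⟨a, b, hab, fun y hy => ⟨a i, b i, hab i, fun t h1 h2 => h _ ⟨fun j hj => ?_, fun j hj => ?_⟩⟩⟩
  · by_cases hji : j = i
    · subst hji; simpa using ⟨h1, h2⟩
    · rw [Function.update_of_ne hji]
      exact hy.1 j (Finset.mem_of_mem_insert_of_ne hj hji)
  · rw [Finset.mem_insert, not_or] at hj
    rw [Function.update_of_ne hj.1]
    exact hy.2 j hj.2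

variable [L.Structure M] [L.IsOrdered] [L.OrderedStructure M]

instance DefP.hasBox [Finite ι] {α : Type} [Finite α] (I : Finset ι)
    (P : (α → M) → (ι → M) → Prop) (f : (α → M) → ι → M)
    [h : DefP L fun w : α ⊕ ι → M => P (fun a => w (Sum.inl a)) (fun i => w (Sum.inr i))]
    [hf : ∀ j, DefF L fun v => f v j] : DefP L (fun v => HasBox I (P v) (f v)) := by
  have hP : ∀ (β : Type) (s : (β → M) → α → M) (t : (β → M) → ι → M) [∀ j, DefF L fun v => s v j]
      [∀ j, DefF L fun v => t v j], DefP L fun v => P (s v) (t v) := by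
    intro β s t hs ht
    have : ∀ j, DefF L fun v => (Sum.elim (s v) (t v) : α ⊕ ι → M) j := by
      rintro (j | j)
      · exact hs j
      · exact ht j
    exact DefP.comp L (hP := h) _ fun v => Sum.elim (s v) (t v)
  have hf' : ∀ (β : Type) (s : (β → M) → α → M) [∀ j, DefF L fun v => s v j] (j : ι),
      DefF L fun v => f (s v) j :=
    fun β s hs j => ⟨Set.DefinableFun.comp (fun i => (hs i).out) (hf j).out⟩
  unfold HasBox InBox
  infer_instance

instance DefP.hasBox_self [Finite ι] (I : Finset ι) (P : (ι → M) → Prop) [hP : DefP L P] :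
    DefP L (HasBox I P) := by
  have hPc := fun (α : Type) f => @DefP.comp L M _ α ι _ P hP f
  exact DefP.hasBox (L := L) I (fun _ : ι → M => P) fun v => v

variable [Finite ι] [TopologicalSpace M] [OrderTopology M] [DenselyOrdered M] [NoMinOrder M]
  [NoMaxOrder M]

/-- As in `HasIoo.swap`, two uses of the section property supply the two endpoints of a side in
direction `i` that is constant over a box. -/
theorem HasBox.insert_of_section {I : Finset ι} {i : ι} (hi : i ∉ I)
    (hsec : ∀ (Q : (ι → M) → M → Prop) [DefT L Q] (y : ι → M),
      HasBox I (fun y => HasIoo (Q y)) y → ∃ c, HasBox I (fun y => Q y c) y)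
    {P : (ι → M) → Prop} [hP : DefP L P] {y₀ : ι → M}
    (h : HasBox I (fun y => HasIoo fun t => P (Function.update y i t)) y₀) :
    HasBox (insert i I) P y₀ := by
  have hP' := fun (α : Type) f => @DefP.comp L M _ α ι _ P hP f
  obtain ⟨c, hc⟩ := hsec (fun y c => ∃ u v, u < c ∧ c < v ∧
    ∀ t, u < t → t < v → P (Function.update y i t)) y₀ (h.mono (by
      rintro y ⟨u, v, huv, h⟩
      exact ⟨u, v, huv, fun t h1 h2 => ⟨u, v, h1, h2, h⟩⟩))
  obtain ⟨c', a, b, hab, h⟩ := hsec (fun y c' => c' < c ∧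
    ∀ t, c' < t → t < c → P (Function.update y i t)) y₀ (hc.mono (by
      rintro y ⟨u, v, huc, hcv, h⟩
      exact ⟨u, c, huc, fun t h1 h2 => ⟨h2, fun t' h3 h4 => h t' (h1.trans h3) (h4.trans hcv)⟩⟩))
  obtain ⟨z, hz⟩ := InBox.exists I hab y₀
  refine ⟨Function.update a i c', Function.update b i c, fun j => ?_, fun z hz => ?_⟩
  · by_cases hj : j = i
    · subst hj; simpa using (h z hz).1
    · simpa [Function.update_of_ne hj] using hab j
  · have hzi := hz.1 i (Finset.mem_insert_self _ _)
    simp only [Function.update_self] at hzi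
    -- A box in the coordinates `I` fixes coordinate `i` at `y₀ i`, so `z` is first moved back to
    -- that value.
    have := (h (Function.update z i (y₀ i)) ⟨fun j hj => ?_, fun j hj => ?_⟩).2 (z i) hzi.1 hzi.2
    · simpa using this
    · have hji : j ≠ i := by rintro rfl; exact hi hj
      simpa [Function.update_of_ne hji] using hz.1 j (Finset.mem_insert_of_mem hj)
    · by_cases hji : j = i
      · subst hji; simp
      · simpa [Function.update_of_ne hji] using hz.2 j (by simp [hji, hj])

variable (hloc : LocallyOMinimal L M) (hdc : DefinablyComplete L M)
include hloc hdc

/-- The inductive step moves the interval in the new coordinate past the interval of `c` by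
`HasIoo.swap`, finds `c` by induction, and rebuilds the box by `HasBox.insert_of_section`. -/
theorem HasBox.exists_section (I : Finset ι) (Q : (ι → M) → M → Prop) [hQ : DefT L Q] (y : ι → M)
    (h : HasBox I (fun y => HasIoo (Q y)) y) : ∃ c, HasBox I (fun y => Q y c) y := by
  induction I using Finset.induction_on generalizing Q y with
  | empty =>
    obtain ⟨u, v, huv, h⟩ := hasBox_empty.1 h
    obtain ⟨c, h1, h2⟩ := exists_between huv
    exact ⟨c, hasBox_empty.2 (h c h1 h2)⟩
  | insert i I hi ih =>
    have hQ' := fun (α : Type) f t => @DefP.compT L M _ α ι _ Q hQ f t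
    obtain ⟨c, hc⟩ := ih (fun y c => HasIoo fun t => Q (Function.update y i t) c) y
      ((h.of_insert hi).mono fun y hy => HasIoo.swap hloc hdc hy)
    exact ⟨c, HasBox.insert_of_section (L := L) hi (fun Q _ y h => ih Q y h) hc⟩

/-- An analogue of the Kuratowski–Ulam theorem. -/
theorem hasBox_insert {I : Finset ι} {i : ι} (hi : i ∉ I) {P : (ι → M) → Prop} [hP : DefP L P]
    {y₀ : ι → M} : HasBox (insert i I) P y₀ ↔
      HasBox I (fun y => HasIoo fun t => P (Function.update y i t)) y₀ :=
  ⟨fun h => h.of_insert hi,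
    HasBox.insert_of_section (L := L) hi fun Q _ y h => HasBox.exists_section hloc hdc I Q y h⟩

theorem hasBox_union {I J : Finset ι} (hIJ : Disjoint I J) {P : (ι → M) → Prop} [hP : DefP L P]
    {y₀ : ι → M} : HasBox (I ∪ J) P y₀ ↔ HasBox I (fun y => HasBox J P y) y₀ := by
  induction J using Finset.induction_on generalizing P with
  | empty => simp [hasBox_empty]
  | insert j J hj ih =>
    have hP' := fun (α : Type) f => @DefP.comp L M _ α ι _ P hP f
    rw [Finset.disjoint_insert_right] at hIJ
    rw [Finset.union_insert, hasBox_insert hloc hdc (by simp [hj, hIJ.1]), ih hIJ.2]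
    simp only [hasBox_insert hloc hdc hj]

theorem HasBox.or {I : Finset ι} {P Q : (ι → M) → Prop} [hP : DefP L P] [hQ : DefP L Q]
    {y₀ : ι → M} (h : HasBox I (fun y => P y ∨ Q y) y₀) : HasBox I P y₀ ∨ HasBox I Q y₀ := by
  induction I using Finset.induction_on generalizing P Q with
  | empty => simpa only [hasBox_empty] using h
  | insert i I hi ih =>
    have hP' := fun (α : Type) f => @DefP.comp L M _ α ι _ P hP f
    have hQ' := fun (α : Type) f => @DefP.comp L M _ α ι _ Q hQ f
    rw [hasBox_insert hloc hdc hi, hasBox_insert hloc hdc hi]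
    refine ih ((h.of_insert hi).mono fun y hy => ?_)
    have : Def1 L fun t => P (Function.update y i t) := inferInstance
    exact hy.or hloc

theorem HasBox.exists_mem {β : Type} (S : Finset β) {I : Finset ι} {P : β → (ι → M) → Prop}
    [hP : ∀ s, DefP L (P s)] {y₀ : ι → M} (h : HasBox I (fun y => ∃ s ∈ S, P s y) y₀) :
    ∃ s ∈ S, HasBox I (P s) y₀ := by
  classical
  induction S using Finset.induction_on with
  | empty => simpa using h.exists
  | insert s S hs ih =>
    have hex : DefP L fun y => ∃ s ∈ S, P s y := by
      have : DefP L fun y => ∃ s : S, P s y := inferInstance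
      simpa using this
    simp only [Finset.mem_insert, exists_eq_or_imp] at h ⊢
    exact (h.or hloc hdc).imp id ih

end Boxes

/-! ### Rank of coordinate sets and its additivity. -/

section Rank

variable {L : FirstOrder.Language.{u, v}} {M : Type w} [LinearOrder M] {ι : Type}

/-- The cylinder over the projection of `Z` to the coordinates from `S`. -/
def Cyl (S : Finset ι) (Z : (ι → M) → Prop) (y : ι → M) : Prop := ∃ x, Z x ∧ ∀ i ∈ S, x i = y i

/-- The projection of `Z` to the coordinates from `C` has dimension at least `k`. -/
def RankGE (C : Finset ι) (Z : (ι → M) → Prop) (k : ℕ) : Prop :=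
  ∃ I ⊆ C, k ≤ I.card ∧ ∃ y, HasBox I (Cyl I Z) y

instance DefP.cyl [L.Structure M] [Finite ι] {α : Type} [Finite α] (S : Finset ι)
    (Z : (α → M) → (ι → M) → Prop) (f : (α → M) → ι → M)
    [h : DefP L fun w : α ⊕ ι → M => Z (fun a => w (Sum.inl a)) (fun i => w (Sum.inr i))]
    [hf : ∀ j, DefF L fun v => f v j] : DefP L (fun v => Cyl S (Z v) (f v)) := by
  have hf' : ∀ (j : ι), DefF L fun v : α ⊕ ι → M => f (fun a => v (Sum.inl a)) j :=
    fun j => ⟨Set.DefinableFun.comp (fun i => (DefF.coord L _).out) (hf j).out⟩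
  unfold Cyl
  infer_instance

instance DefP.cyl_self [L.Structure M] [Finite ι] (S : Finset ι) (Z : (ι → M) → Prop)
    [hZ : DefP L Z] : DefP L (Cyl S Z) := by
  have hZc := fun (α : Type) f => @DefP.comp L M _ α ι _ Z hZ f
  exact DefP.cyl (L := L) S (fun _ : ι → M => Z) fun v => v

theorem Cyl.mono {S : Finset ι} {Z Z' : (ι → M) → Prop} (hZ : ∀ z, Z z → Z' z) {y : ι → M}
    (h : Cyl S Z y) : Cyl S Z' y := by
  obtain ⟨x, hx, h⟩ := h
  exact ⟨x, hZ x hx, h⟩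

theorem RankGE.mono {C C' : Finset ι} {Z Z' : (ι → M) → Prop} {k k' : ℕ} (h : RankGE C Z k)
    (hC : C ⊆ C') (hZ : ∀ z, Z z → Z' z) (hk : k' ≤ k) : RankGE C' Z' k' := by
  obtain ⟨I, hI, hkI, y, hy⟩ := h
  exact ⟨I, hI.trans hC, hk.trans hkI, y, hy.mono fun z => Cyl.mono hZ⟩

theorem RankGE.exists [DenselyOrdered M] {C : Finset ι} {Z : (ι → M) → Prop} {k : ℕ}
    (h : RankGE C Z k) : ∃ z, Z z := by
  obtain ⟨I, -, -, y, hy⟩ := h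
  obtain ⟨-, x, hx, -⟩ := hy.exists
  exact ⟨x, hx⟩

theorem rankGE_zero [NoMaxOrder M] (C : Finset ι) {Z : (ι → M) → Prop} {z : ι → M} (hz : Z z) :
    RankGE C Z 0 :=
  ⟨∅, by simp, by simp, z, hasBox_empty.2 ⟨z, hz, by simp⟩⟩

theorem HasBox.cyl_subset [DenselyOrdered M] {I J : Finset ι} (hJI : J ⊆ I) {Z : (ι → M) → Prop}
    {y : ι → M} (h : HasBox I (Cyl I Z) y) : HasBox J (Cyl J Z) y := by
  classical
  obtain ⟨a, b, hab, h⟩ := h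
  choose c hc using fun j => exists_between (hab j)
  refine ⟨a, b, hab, fun w hw => ?_⟩
  obtain ⟨x, hx, hxw⟩ := h (fun i => if i ∈ J then w i else if i ∈ I then c i else y i) (by
    refine ⟨fun j hj => ?_, fun j hj => ?_⟩
    · by_cases hjJ : j ∈ J
      · simpa [hjJ] using hw.1 j hjJ
      · simpa [hjJ, hj] using hc j
    · have : j ∉ J := fun h => hj (hJI h)
      simp [this, hj])
  exact ⟨x, hx, fun i hi => by simpa [hi] using hxw i (hJI hi)⟩

theorem HasBox.cyl_base {I : Finset ι} {Z : (ι → M) → Prop} {y : ι → M}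
    (h : HasBox I (Cyl I Z) y) (y' : ι → M) : HasBox I (Cyl I Z) y' := by
  classical
  obtain ⟨a, b, hab, h⟩ := h
  refine ⟨a, b, hab, fun w hw => ?_⟩
  obtain ⟨x, hx, hxw⟩ := h (fun i => if i ∈ I then w i else y i)
    ⟨fun j hj => by simpa [hj] using hw.1 j hj, fun j hj => by simp [hj]⟩
  exact ⟨x, hx, fun i hi => by simpa [hi] using hxw i hi⟩

variable [DecidableEq ι]

theorem RankGE.of_insert [DenselyOrdered M] {C : Finset ι} {c : ι} {Z : (ι → M) → Prop} {k : ℕ}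
    (h : RankGE (insert c C) Z (k + 1)) : RankGE C Z k := by
  obtain ⟨I, hI, hk, y, hy⟩ := h
  refine ⟨I.erase c, ?_, ?_, y, hy.cyl_subset (Finset.erase_subset _ _)⟩
  · exact (Finset.erase_subset_erase c hI).trans (Finset.erase_insert_subset c C)
  · have := Finset.pred_card_le_card_erase (s := I) (a := c)
    omega

variable [Finite ι] [L.Structure M] [L.IsOrdered] [L.OrderedStructure M] [TopologicalSpace M]
  [OrderTopology M] [DenselyOrdered M] [NoMinOrder M] [NoMaxOrder M]

/-- Points isolated by boxes form a discrete set, so each coordinate image is discrete, whereas an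
interval in a dense order is not. -/
theorem not_hasIoo_of_isolated (hdisc : DiscreteImages L M) {W : (ι → M) → Prop} [hW : DefP L W]
    (hiso : ∀ v, W v → ∃ b c : ι → M, (∀ i, b i < v i ∧ v i < c i) ∧
      ∀ v', W v' → (∀ i, b i < v' i ∧ v' i < c i) → v' = v) (i : ι) :
    ¬ HasIoo fun t => ∃ v, W v ∧ v i = t := by
  have hW' := fun (α : Type) f => @DefP.comp L M _ α ι _ W hW f
  rintro ⟨p, q, hpq, h⟩
  obtain ⟨t, hpt, htq⟩ := exists_between hpq
  obtain ⟨n, ⟨e⟩⟩ := Finite.exists_equiv_fin ι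
  have hXdef : DefP L fun x : Fin n → M => W (fun i => x (e i)) := inferInstance
  have hX : IsDiscrete {x : Fin n → M | W (fun i => x (e i))} := by
    rw [isDiscrete_iff_nhdsWithin]
    intro x hx
    obtain ⟨b, c, hbc, hiso⟩ := hiso _ hx
    have hU : Set.univ.pi (fun k => Set.Ioo (b (e.symm k)) (c (e.symm k))) ∈ 𝓝 x :=
      set_pi_mem_nhds Set.finite_univ fun k _ => by
        have := hbc (e.symm k)
        simp only [Equiv.apply_symm_apply] at this
        exact Ioo_mem_nhds this.1 this.2
    refine le_antisymm ?_ (pure_le_nhdsWithin hx)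
    rw [le_pure_iff]
    refine mem_of_superset (inter_mem_nhdsWithin _ hU) ?_
    rintro x' ⟨hx', hU'⟩
    have := hiso (fun i => x' (e i)) hx' fun i => by simpa using hU' (e i) trivial
    exact funext fun k => by simpa using congrFun this (e.symm k)
  obtain ⟨v₀, hv₀, -⟩ := h t hpt htq
  have hS := hdisc n 1 ⟨fun _ => e i, fun _ _ _ => Subsingleton.elim _ _⟩ _
    ⟨fun k => v₀ (e.symm k), by simpa using hv₀⟩ hXdef.out hX
  have hmem : ∀ t, p < t → t < q → (fun _ => t) ∈
      proj ⟨fun _ : Fin 1 => e i, fun _ _ _ => Subsingleton.elim _ _⟩ ''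
        {x : Fin n → M | W (fun i => x (e i))} := by
    intro t h1 h2
    obtain ⟨v, hv, rfl⟩ := h t h1 h2
    exact ⟨fun k => v (e.symm k), by simpa using hv, by funext; exact congrArg v (e.symm_apply_apply i)⟩
  obtain ⟨U, hU, hUS⟩ := isOpen_inter_eq_singleton_of_mem_discrete hS (hmem t hpt htq)
  have hUt : (fun _ => t) ∈ U := (hUS.symm ▸ Set.mem_singleton _ : (fun _ => t) ∈ U ∩ _).1
  have hcont : Continuous fun (t : M) (_ : Fin 1) => t := continuous_pi fun _ => continuous_id
  have hnhds : (fun (t : M) (_ : Fin 1) => t) ⁻¹' U ∈ 𝓝[>] t :=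
    mem_nhdsWithin_of_mem_nhds ((hU.preimage hcont).mem_nhds hUt)
  obtain ⟨s, hts, hs⟩ := mem_nhdsGT_iff_exists_Ioo_subset.1 hnhds
  obtain ⟨t', htt', ht's⟩ := exists_between (lt_min (show t < s from hts) htq)
  have : (fun _ => t') ∈ U ∩ _ := ⟨hs ⟨htt', ht's.trans_le (min_le_left _ _)⟩,
    hmem t' (hpt.trans htt') (ht's.trans_le (min_le_right _ _))⟩
  rw [hUS] at this
  exact htt'.ne' (congrFun this 0)

variable (hloc : LocallyOMinimal L M) (hdc : DefinablyComplete L M)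

section
include hloc hdc

theorem RankGE.or {C : Finset ι} {Z Z' : (ι → M) → Prop} [hZ : DefP L Z] [hZ' : DefP L Z'] {k : ℕ}
    (h : RankGE C (fun z => Z z ∨ Z' z) k) : RankGE C Z k ∨ RankGE C Z' k := by
  have hZc := fun (α : Type) f => @DefP.comp L M _ α ι _ Z hZ f
  have hZc' := fun (α : Type) f => @DefP.comp L M _ α ι _ Z' hZ' f
  obtain ⟨I, hI, hk, y, hy⟩ := h
  have : HasBox I (fun z => Cyl I Z z ∨ Cyl I Z' z) y := hy.mono (by
    rintro w ⟨x, hx | hx, h⟩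
    · exact Or.inl ⟨x, hx, h⟩
    · exact Or.inr ⟨x, hx, h⟩)
  rcases this.or hloc hdc with h | h
  · exact Or.inl ⟨I, hI, hk, y, h⟩
  · exact Or.inr ⟨I, hI, hk, y, h⟩

theorem RankGE.insert_of_hasIoo {C : Finset ι} {c : ι} (hc : c ∉ C) {Z : (ι → M) → Prop}
    [hZ : DefP L Z]
    (hfib : ∀ z, Z z → HasIoo fun t => ∃ z', Z z' ∧ (∀ i ∈ C, z' i = z i) ∧ z' c = t) {k : ℕ}
    (h : RankGE C Z k) : RankGE (insert c C) Z (k + 1) := by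
  have hZc := fun (α : Type) f => @DefP.comp L M _ α ι _ Z hZ f
  obtain ⟨I, hI, hk, y, hy⟩ := h
  have hcI : c ∉ I := fun h => hc (hI h)
  refine ⟨insert c I, Finset.insert_subset_insert c hI, ?_, y,
    (hasBox_insert hloc hdc hcI).2 (hy.mono ?_)⟩
  · rw [Finset.card_insert_of_notMem hcI]; omega
  · rintro w ⟨x, hx, hxw⟩
    refine (hfib x hx).mono ?_
    rintro t ⟨z', hz', h1, h2⟩
    refine ⟨z', hz', fun i hi => ?_⟩
    by_cases hic : i = c
    · subst hic; simpa using h2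
    · have := Finset.mem_of_mem_insert_of_ne hi hic
      rw [Function.update_of_ne hic, h1 i (hI this), hxw i this]

/-- The lower bound for the rank of a union. The coordinates `J` of a box in the fibre may vary with
the base point, but there are finitely many choices, so one `J` serves over a whole box;
`hasBox_union` then merges base and fibre. -/
theorem RankGE.union_of_fibers {A C : Finset ι} (hAC : Disjoint A C) {Z : (ι → M) → Prop}
    [hZ : DefP L Z] {d k : ℕ}
    (hfib : ∀ x, Z x → RankGE C (fun z => Z z ∧ ∀ i ∈ A, z i = x i) d) (h : RankGE A Z k) :
    RankGE (A ∪ C) Z (k + d) := by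
  have hZc := fun (α : Type) f => @DefP.comp L M _ α ι _ Z hZ f
  obtain ⟨I, hI, hk, y, hy⟩ := h
  have key : HasBox I (fun w => ∃ J ∈ C.powerset.filter (fun J => d ≤ J.card),
      HasBox J (Cyl (I ∪ J) Z) w) y := by
    refine hy.mono ?_
    rintro w ⟨x, hx, hxw⟩
    obtain ⟨J, hJ, hd, y', hy'⟩ := hfib x hx
    obtain ⟨a, b, hab, h⟩ := hy'.cyl_base w
    refine ⟨J, by simp [hJ, hd], a, b, hab, fun v hv => ?_⟩
    obtain ⟨z, ⟨hz, hzx⟩, hzv⟩ := h v hv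
    refine ⟨z, hz, fun i hi => ?_⟩
    rcases Finset.mem_union.1 hi with hi | hi
    · have : i ∉ J := fun h => Finset.disjoint_left.1 hAC (hI hi) (hJ h)
      rw [hv.2 i this, hzx i (hI hi), hxw i hi]
    · exact hzv i hi
  obtain ⟨J, hJ, hbox⟩ := key.exists_mem hloc hdc
  simp only [Finset.mem_filter, Finset.mem_powerset] at hJ
  have hdis : Disjoint I J := Finset.disjoint_of_subset_left hI
    (Finset.disjoint_of_subset_right hJ.1 hAC)
  refine ⟨I ∪ J, Finset.union_subset_union hI hJ.1, ?_, y, (hasBox_union hloc hdc hdis).2 hbox⟩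
  rw [Finset.card_union_of_disjoint hdis]
  omega

end

variable (hdisc : DiscreteImages L M)
include hloc hdc hdisc

/-- The exchange step. If every `j ∈ E \ J` failed, then over the point `w` of the `J`-coordinates
each coordinate from `E` would take isolated values, and so would `c` once these are fixed. The
slice would be discrete while its image in coordinate `c` contains an interval. -/
theorem exists_hasIoo_of_discrete_fibers {E J : Finset ι} {c : ι} (hJE : J ⊆ E) (hc : c ∉ E)
    {Z : (ι → M) → Prop} [hZ : DefP L Z]
    (hfib : ∀ z, Z z → ¬ HasIoo fun t => ∃ z', Z z' ∧ (∀ i ∈ E, z' i = z i) ∧ z' c = t)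
    {w : ι → M} (hw : HasIoo fun t => Cyl (insert c J) Z (Function.update w c t)) :
    ∃ j ∈ E \ J, HasIoo fun t => Cyl (insert j J) Z (Function.update w j t) := by
  have hZc := fun (α : Type) f => @DefP.comp L M _ α ι _ Z hZ f
  by_contra! hcon
  -- The slice of `Z` over `w`, projected to `insert c E`; the irrelevant coordinates are frozen at
  -- those of `w` so that they cannot spoil discreteness.
  let W : (ι → M) → Prop := fun v => ∃ z, Z z ∧ (∀ i ∈ J, z i = w i) ∧
    ∀ i, v i = if i ∈ insert c E then z i else w i
  have hWdef : DefP L W := by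
    change DefP L fun v => ∃ z, Z z ∧ (∀ i ∈ J, z i = w i) ∧
      ∀ i, v i = if i ∈ insert c E then z i else w i
    infer_instance
  refine not_hasIoo_of_isolated (W := W) hdisc ?_ c (hw.mono ?_)
  · rintro v ⟨z, hz, hzJ, hzv⟩
    have hcyl : ∀ z' : ι → M, Z z' → (∀ i ∈ J, z' i = w i) → ∀ j,
        Cyl (insert j J) Z (Function.update w j (z' j)) := by
      intro z' hz' hzJ' j
      refine ⟨z', hz', fun i hi => ?_⟩
      by_cases hij : i = j
      · subst hij; simp
      · rw [Function.update_of_ne hij, hzJ' i (Finset.mem_of_mem_insert_of_ne hi hij)]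
    have hi : ∀ i, ∃ b c', b < v i ∧ v i < c' ∧
        (i ∈ E \ J → ∀ t, b < t → t < c' → Cyl (insert i J) Z (Function.update w i t) → t = v i) ∧
        (i = c → ∀ t, b < t → t < c' →
          (∃ z', Z z' ∧ (∀ i ∈ E, z' i = z i) ∧ z' c = t) → t = v i) := by
      intro i
      by_cases hiE : i ∈ E \ J
      · obtain ⟨b, c', hb, hc', h⟩ := exists_isolating hloc (hcon i hiE) (v i)
        refine ⟨b, c', hb, hc', fun _ => h, ?_⟩
        rintro rfl
        exact absurd (Finset.mem_sdiff.1 hiE).1 hc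
      · obtain ⟨b, c', hb, hc', h⟩ := exists_isolating hloc (hfib z hz) (v i)
        exact ⟨b, c', hb, hc', fun h => absurd h hiE, fun _ => h⟩
    choose b c' hb hc' h1 h2 using hi
    refine ⟨b, c', fun i => ⟨hb i, hc' i⟩, ?_⟩
    rintro v' ⟨z', hz', hzJ', hzv'⟩ hv'
    have hE : ∀ i ∈ E, z' i = z i := by
      intro i hi
      by_cases hiJ : i ∈ J
      · rw [hzJ i hiJ, hzJ' i hiJ]
      have e1 : v' i = z' i := by simpa [hi] using hzv' i
      have e2 : v i = z i := by simpa [hi] using hzv i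
      rw [← e1, ← e2]
      refine h1 i (Finset.mem_sdiff.2 ⟨hi, hiJ⟩) _ (hv' i).1 (hv' i).2 ?_
      rw [e1]
      exact hcyl z' hz' hzJ' i
    have hcc : v' c = v c := by
      refine h2 c rfl _ (hv' c).1 (hv' c).2 ⟨z', hz', hE, ?_⟩
      simpa using (hzv' c).symm
    funext i
    by_cases hic : i = c
    · subst hic; exact hcc
    · rw [hzv, hzv']
      by_cases hiE : i ∈ E
      · simp [hiE, hE i hiE]
      · simp [hic, hiE]
  · rintro t ⟨z, hz, hzw⟩
    refine ⟨fun i => if i ∈ insert c E then z i else w i, ⟨z, hz, fun i hi => ?_, fun i => rfl⟩, ?_⟩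
    · have hic : i ≠ c := by rintro rfl; exact hc (hJE hi)
      simpa [Function.update_of_ne hic] using hzw i (Finset.mem_insert_of_mem hi)
    · simpa using hzw c (Finset.mem_insert_self _ _)

/-- If `c` is among the coordinates of the box, the exchange step offers a replacement at every
point of a smaller box; finiteness makes one replacement valid over a box. -/
theorem RankGE.of_insert_of_discrete {E : Finset ι} {c : ι} (hc : c ∉ E) {Z : (ι → M) → Prop}
    [hZ : DefP L Z]
    (hfib : ∀ z, Z z → ¬ HasIoo fun t => ∃ z', Z z' ∧ (∀ i ∈ E, z' i = z i) ∧ z' c = t) {k : ℕ}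
    (h : RankGE (insert c E) Z k) : RankGE E Z k := by
  have hZc := fun (α : Type) f => @DefP.comp L M _ α ι _ Z hZ f
  obtain ⟨I, hI, hk, y, hy⟩ := h
  by_cases hcI : c ∈ I
  · obtain ⟨J, hcJ, rfl⟩ : ∃ J, c ∉ J ∧ insert c J = I :=
      ⟨I.erase c, Finset.notMem_erase _ _, Finset.insert_erase hcI⟩
    have hJE : J ⊆ E := (Finset.insert_subset_insert_iff hcJ).1 hI
    rw [Finset.card_insert_of_notMem hcJ] at hk
    obtain ⟨j, hj, hbox⟩ := HasBox.exists_mem (L := L) hloc hdc (E \ J)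
      ((hy.of_insert hcJ).mono fun w hw =>
        exists_hasIoo_of_discrete_fibers hloc hdc hdisc hJE hc hfib hw)
    rw [Finset.mem_sdiff] at hj
    refine ⟨insert j J, Finset.insert_subset hj.1 hJE, ?_, y, (hasBox_insert hloc hdc hj.2).2 hbox⟩
    rwa [Finset.card_insert_of_notMem hj.2]
  · exact ⟨I, (Finset.subset_insert_iff_of_notMem hcI).1 hI, hk, y, hy⟩

/-- The upper bound for the rank of a union, by removing one coordinate `c` at a time. Splitting by
`T` makes the fibres in direction `c` either all free of intervals or all containing one. -/
theorem RankGE.of_union_of_fibers {A C : Finset ι} (hAC : Disjoint A C) {Z : (ι → M) → Prop}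
    [hZ : DefP L Z] {d k : ℕ}
    (hfib : ∀ x, Z x → ¬ RankGE C (fun z => Z z ∧ ∀ i ∈ A, z i = x i) (d + 1))
    (h : RankGE (A ∪ C) Z (k + d)) : RankGE A Z k := by
  induction C using Finset.induction_on generalizing Z d with
  | empty => exact h.mono (by simp) (fun _ => id) (by omega)
  | insert c C hcC ih =>
    have hZc := fun (α : Type) f => @DefP.comp L M _ α ι _ Z hZ f
    rw [Finset.disjoint_insert_right] at hAC
    have hcE : c ∉ A ∪ C := by simp [hAC.1, hcC]
    let T : (ι → M) → Prop := fun z =>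
      HasIoo fun t => ∃ z', Z z' ∧ (∀ i ∈ A ∪ C, z' i = z i) ∧ z' c = t
    have hTcongr : ∀ z z', (∀ i ∈ A ∪ C, z' i = z i) → T z → T z' := by
      refine fun z z' hzz hz => hz.mono ?_
      rintro t ⟨x, hx, h1, h2⟩
      exact ⟨x, hx, fun i hi => (h1 i hi).trans (hzz i hi).symm, h2⟩
    have hT : DefP L T := by
      change DefP L fun z => HasIoo fun t => ∃ z', Z z' ∧ (∀ i ∈ A ∪ C, z' i = z i) ∧ z' c = t
      infer_instance
    have hTc := fun (α : Type) f => @DefP.comp L M _ α ι _ T hT f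
    have hsplit : RankGE (insert c (A ∪ C)) (fun z => (Z z ∧ ¬ T z) ∨ (Z z ∧ T z)) (k + d) := by
      rw [← Finset.union_insert]
      exact h.mono subset_rfl (fun z hz => by tauto) le_rfl
    rcases hsplit.or hloc hdc with h0 | h1
    · refine (ih hAC.2 (Z := fun z => Z z ∧ ¬ T z) (d := d) ?_
        (h0.of_insert_of_discrete hloc hdc hdisc hcE ?_)).mono subset_rfl (fun z hz => hz.1) le_rfl
      · exact fun x hx hr => hfib x hx.1 (hr.mono (Finset.subset_insert _ _)
          (fun z hz => ⟨hz.1.1, hz.2⟩) le_rfl)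
      · refine fun z hz hr => hz.2 (hr.mono ?_)
        rintro t ⟨z', h1, h2⟩
        exact ⟨z', h1.1, h2⟩
    -- On this part restoring `c` raises the fibre rank by one, so the rank on `C` is below `d`.
    -- This offsets the at most one unit lost in total rank when `c` is removed.
    · have hno : ∀ x, Z x ∧ T x → ¬ RankGE C (fun z => (Z z ∧ T z) ∧ ∀ i ∈ A, z i = x i) d := by
        intro x hx hr
        refine hfib x hx.1 ((hr.insert_of_hasIoo hloc hdc hcC ?_).mono subset_rfl
          (fun z hz => ⟨hz.1.1, hz.2⟩) le_rfl)
        rintro z ⟨⟨hz, hTz⟩, hzx⟩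
        refine hTz.mono ?_
        rintro t ⟨z', hz', h2, h3⟩
        exact ⟨z', ⟨⟨hz', hTcongr _ _ h2 hTz⟩, fun i hi => (h2 i (by simp [hi])).trans (hzx i hi)⟩,
          fun i hi => h2 i (by simp [hi]), h3⟩
      obtain ⟨x, hx⟩ := h1.exists
      cases d with
      -- A nonempty fibre has rank at least zero, so this part is empty when `d = 0`.
      | zero => exact absurd (rankGE_zero C ⟨hx, fun _ _ => rfl⟩) (hno x hx)
      | succ d =>
        exact (ih hAC.2 (Z := fun z => Z z ∧ T z) hno h1.of_insert).mono subset_rfl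
          (fun z hz => hz.1) le_rfl

end Rank

/-! ### Dimension expressed as rank. -/

section Dimension

variable {M : Type w} [LinearOrder M] [DenselyOrdered M] [NoMinOrder M] [NoMaxOrder M] [Nonempty M]
  [TopologicalSpace M] [OrderTopology M]

theorem nonempty_interior_iff {d : ℕ} {S : Set (Fin d → M)} :
    (interior S).Nonempty ↔ ∃ a b : Fin d → M, (∀ i, a i < b i) ∧
      ∀ x, (∀ i, a i < x i ∧ x i < b i) → x ∈ S := by
  constructor
  · rintro ⟨x, hx⟩
    rw [mem_interior_iff_mem_nhds, nhds_pi, Filter.mem_pi] at hx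
    obtain ⟨I, -, t, ht, hS⟩ := hx
    choose l u hlu h using fun i => mem_nhds_iff_exists_Ioo_subset.1 (ht i)
    exact ⟨l, u, fun i => (hlu i).1.trans (hlu i).2, fun y hy => hS fun i _ => h i (hy i)⟩
  · rintro ⟨a, b, hab, h⟩
    choose c hc using fun i => exists_between (hab i)
    exact ⟨c, mem_interior_iff_mem_nhds.2 (mem_of_superset (set_pi_mem_nhds Set.finite_univ
      fun i _ => Ioo_mem_nhds (hc i).1 (hc i).2) fun y hy => h y fun i => hy i trivial)⟩

theorem le_dim_iff {n : ℕ} {X : Set (Fin n → M)} {k : ℕ} :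
    (k : WithBot ℕ) ≤ dim X ↔
      ∃ d, k ≤ d ∧ ∃ σ : Fin d ↪ Fin n, (interior (proj σ '' X)).Nonempty := by
  classical
  unfold dim
  constructor
  · intro h
    obtain ⟨d, hd⟩ : ∃ d : ℕ, (d : WithBot ℕ) = _ := WithBot.ne_bot_iff_exists.1
      (ne_bot_of_le_ne_bot (WithBot.coe_ne_bot (a := k)) h)
    have hmem := Finset.mem_of_max hd.symm
    rw [← hd] at h
    have h : k ≤ d := by exact_mod_cast h
    exact ⟨d, h, (Finset.mem_filter.1 hmem).2⟩
  · rintro ⟨d, hk, σ, hσ⟩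
    have hdn : d ≤ n := by simpa using Fintype.card_le_of_embedding σ
    exact (WithBot.coe_le_coe.2 hk).trans (Finset.le_max
      (Finset.mem_filter.2 ⟨Finset.mem_range.2 (Nat.lt_succ_of_le hdn), σ, hσ⟩))

theorem le_dim_iff_rankGE {ι : Type} {n : ℕ} (e : Fin n ↪ ι) {Z : (ι → M) → Prop}
    {X : Set (Fin n → M)} (hX : ∀ x, x ∈ X ↔ ∃ z, Z z ∧ ∀ i, z (e i) = x i) {k : ℕ} :
    (k : WithBot ℕ) ≤ dim X ↔ RankGE (Finset.univ.map e) Z k := by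
  obtain ⟨p⟩ := ‹Nonempty M›
  obtain ⟨q, hpq⟩ := exists_gt p
  rw [le_dim_iff]
  constructor
  · rintro ⟨d, hkd, σ, hσ⟩
    obtain ⟨a, b, hab, h⟩ := nonempty_interior_iff.1 hσ
    -- Outside the range of `s` the corners of the box are padded with `p < q`, since `HasBox`
    -- demands nondegenerate sides in all coordinates.
    let s : Fin d ↪ ι := σ.trans e
    refine ⟨Finset.univ.map s, ?_, by simpa using hkd, fun _ => p,
      Function.extend s a fun _ => p, Function.extend s b fun _ => q, fun j => ?_, fun w hw => ?_⟩
    · intro i hi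
      obtain ⟨j, -, rfl⟩ := Finset.mem_map.1 hi
      exact Finset.mem_map_of_mem e (Finset.mem_univ (σ j))
    · by_cases hj : ∃ i, s i = j
      · obtain ⟨i, rfl⟩ := hj
        simpa [s.injective.extend_apply] using hab i
      · simpa [Function.extend_apply' _ _ _ hj] using hpq
    · obtain ⟨x, hx, hxw⟩ := h (fun i => w (s i)) fun i => by
        simpa [s.injective.extend_apply] using hw.1 (s i) (Finset.mem_map_of_mem s (Finset.mem_univ i))
      obtain ⟨z, hz, hzx⟩ := (hX x).1 hx
      refine ⟨z, hz, fun i hi => ?_⟩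
      obtain ⟨j, -, rfl⟩ := Finset.mem_map.1 hi
      exact (hzx (σ j)).trans (congrFun hxw j)
  · rintro ⟨I, hI, hk, y, a, b, hab, h⟩
    obtain ⟨I', -, rfl⟩ := Finset.subset_map_iff.1 hI
    rw [Finset.card_map] at hk
    let σ : Fin I'.card ↪ Fin n := (I'.orderEmbOfFin rfl).toEmbedding
    let s : Fin I'.card ↪ ι := σ.trans e
    refine ⟨I'.card, hk, σ, nonempty_interior_iff.2
      ⟨fun i => a (s i), fun i => b (s i), fun i => hab _, fun x hx => ?_⟩⟩
    have hmem : ∀ j, j ∈ I'.map e ↔ ∃ i, s i = j := by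
      intro j
      rw [Finset.mem_map]
      constructor
      · rintro ⟨i, hi, rfl⟩
        have : i ∈ Set.range (I'.orderEmbOfFin rfl) := by rwa [Finset.range_orderEmbOfFin]
        obtain ⟨k, rfl⟩ := this
        exact ⟨k, rfl⟩
      · rintro ⟨i, rfl⟩
        exact ⟨σ i, Finset.orderEmbOfFin_mem _ _ _, rfl⟩
    obtain ⟨z, hz, hzw⟩ := h (Function.extend s x y) ⟨fun j hj => by
      obtain ⟨i, rfl⟩ := (hmem j).1 hj
      simpa [s.injective.extend_apply] using hx i, fun j hj => by
      rw [hmem] at hj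
      exact Function.extend_apply' _ _ _ hj⟩
    refine ⟨fun i => z (e i), (hX _).2 ⟨z, hz, fun i => rfl⟩, funext fun i => ?_⟩
    exact (hzw (s i) ((hmem _).2 ⟨i, rfl⟩)).trans (s.injective.extend_apply x y i)

end Dimension
end LocOMin

/-! ### The addition formula, read off from the graph. -/

theorem mainTheorem2 (L : FirstOrder.Language.{u, v}) [L.IsOrdered]
    (M : Type w) [Nonempty M] [LinearOrder M] [DenselyOrdered M] [NoMinOrder M] [NoMaxOrder M]
    [TopologicalSpace M] [OrderTopology M] [L.Structure M] [L.OrderedStructure M]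
    (hloc : LocOMin.LocallyOMinimal L M) (hdc : LocOMin.DefinablyComplete L M)
    (hdisc : LocOMin.DiscreteImages L M)
    {m n : ℕ} (X : Set (Fin m → M)) (Y : Set (Fin n → M))
    (hX : LocOMin.Def L X) (hY : LocOMin.Def L Y)
    (φ : X → Y) (hφ : LocOMin.DefMap L φ) (hsurj : Function.Surjective φ)
    (hequi : ∀ y y' : Y,
      LocOMin.dim (LocOMin.fiber φ y) = LocOMin.dim (LocOMin.fiber φ y')) :
    ∀ y : Y, LocOMin.dim X = LocOMin.dim Y + LocOMin.dim (LocOMin.fiber φ y) := by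
  intro y
  let G : (Fin m ⊕ Fin n → M) → Prop := fun z =>
    ∃ x : X, z ∘ Sum.inl = (x : Fin m → M) ∧ z ∘ Sum.inr = (φ x : Fin n → M)
  have hG : LocOMin.DefP L G := ⟨hφ⟩
  let C : Finset (Fin m ⊕ Fin n) := Finset.univ.map Function.Embedding.inl
  let A : Finset (Fin m ⊕ Fin n) := Finset.univ.map Function.Embedding.inr
  have hAC : Disjoint A C := by
    rw [Finset.disjoint_left]
    intro i hi hi'
    obtain ⟨j, -, rfl⟩ := Finset.mem_map.1 hi
    simp [C] at hi'
  have hdimX : ∀ k : ℕ, (k : WithBot ℕ) ≤ LocOMin.dim X ↔ LocOMin.RankGE C G k := fun k =>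
    LocOMin.le_dim_iff_rankGE Function.Embedding.inl (by
      intro x
      constructor
      · exact fun hx => ⟨Sum.elim x (φ ⟨x, hx⟩), ⟨⟨x, hx⟩, by simp, by simp⟩, by simp⟩
      · rintro ⟨z, ⟨x', h1, -⟩, h⟩
        have : x = x' := by rw [← h1]; funext i; exact (h i).symm
        exact this ▸ x'.2)
  have hdimY : ∀ k : ℕ, (k : WithBot ℕ) ≤ LocOMin.dim Y ↔ LocOMin.RankGE A G k := fun k =>
    LocOMin.le_dim_iff_rankGE Function.Embedding.inr (by
      intro y
      constructor
      · intro hy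
        obtain ⟨x, hx⟩ := hsurj ⟨y, hy⟩
        exact ⟨Sum.elim x y, ⟨x, by simp, by simp [hx]⟩, by simp⟩
      · rintro ⟨z, ⟨x', -, h1⟩, h⟩
        have : y = φ x' := by rw [← h1]; funext i; exact (h i).symm
        exact this ▸ (φ x').2)
  have hdimF : ∀ (k : ℕ) (z : Fin m ⊕ Fin n → M), G z → ((k : WithBot ℕ) ≤ LocOMin.dim (LocOMin.fiber φ y) ↔
      LocOMin.RankGE C (fun z' => G z' ∧ ∀ i ∈ A, z' i = z i) k) := by
    rintro k z ⟨x₀, h1, h2⟩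
    rw [hequi y (φ x₀)]
    refine LocOMin.le_dim_iff_rankGE Function.Embedding.inl fun x => ?_
    constructor
    · rintro ⟨x', hx', rfl⟩
      refine ⟨Sum.elim x' (φ x'), ⟨⟨x', by simp, by simp⟩, fun i hi => ?_⟩, by simp⟩
      obtain ⟨j, -, rfl⟩ := Finset.mem_map.1 hi
      rw [Set.mem_preimage, Set.mem_singleton_iff] at hx'
      rw [hx']
      exact (congrFun h2 j).symm
    · rintro ⟨z', ⟨⟨x', h3, h4⟩, h5⟩, h⟩
      refine ⟨x', Subtype.ext ?_, ?_⟩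
      · rw [← h4, ← h2]
        exact funext fun j => h5 _ (Finset.mem_map_of_mem _ (Finset.mem_univ j))
      · rw [← h3]
        exact funext fun i => h i
  obtain ⟨x₀, hx₀⟩ := hsurj y
  have hz₀ : G (Sum.elim x₀ (φ x₀)) := ⟨x₀, by simp, by simp⟩
  have hnat : ∀ {D : WithBot ℕ}, ((0 : ℕ) : WithBot ℕ) ≤ D → ∃ d : ℕ, (d : WithBot ℕ) = D :=
    fun h => WithBot.ne_bot_iff_exists.1 (ne_bot_of_le_ne_bot (WithBot.coe_ne_bot (a := 0)) h)
  obtain ⟨d, hd⟩ := hnat ((hdimF 0 _ hz₀).2 (LocOMin.rankGE_zero C ⟨hz₀, fun _ _ => rfl⟩))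
  obtain ⟨r, hr⟩ := hnat ((hdimX 0).2 (LocOMin.rankGE_zero C hz₀))
  obtain ⟨s, hs⟩ := hnat ((hdimY 0).2 (LocOMin.rankGE_zero A hz₀))
  rw [← hd] at hdimF
  rw [← hr] at hdimX
  rw [← hs] at hdimY
  -- The graph has a single point over each point of `X`, so adjoining the coordinates of `Y` does
  -- not raise the rank: the upper bound applies with fibre rank zero.
  have hXG : ∀ k, k ≤ r ↔ LocOMin.RankGE (A ∪ C) G k := by
    intro k
    rw [← WithBot.coe_le_coe (α := ℕ)]
    refine (hdimX k).trans ⟨fun h => h.mono Finset.subset_union_right (fun _ => id) le_rfl,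
      fun h => ?_⟩
    rw [Finset.union_comm] at h
    refine LocOMin.RankGE.of_union_of_fibers (d := 0) hloc hdc hdisc hAC.symm ?_ h
    rintro x ⟨x', h1, h2⟩ ⟨I, hI, hk, y, hy⟩
    obtain ⟨i, hi⟩ : I.Nonempty := Finset.card_pos.1 (by omega)
    obtain ⟨a, b, hab, h⟩ := hy.cyl_subset (Finset.singleton_subset_iff.2 hi)
    -- Positive rank of such a fibre would put an interval of values in a coordinate that is
    -- determined by `x`.
    have huniq : ∀ t, a i < t → t < b i → t = x i := by
      intro t h3 h4
      obtain ⟨z, ⟨⟨x'', h5, h6⟩, h7⟩, h8⟩ := h (Function.update y i t) ⟨by simp [h3, h4], by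
        intro j hj
        exact Function.update_of_ne (by simpa using hj) _ _⟩
      have hx : x'' = x' := Subtype.ext (by
        rw [← h5, ← h1]
        exact funext fun j => h7 _ (Finset.mem_map_of_mem _ (Finset.mem_univ j)))
      subst hx
      obtain ⟨j, -, rfl⟩ := Finset.mem_map.1 (hI hi)
      have := h8 _ (Finset.mem_singleton_self _)
      rw [Function.update_self] at this
      rw [← this]
      exact congrFun (h6.trans h2.symm) j
    obtain ⟨t, h3, h4⟩ := exists_between (hab i)
    obtain ⟨t', h5, h6⟩ := exists_between h4
    exact h5.ne ((huniq t h3 h4).trans (huniq t' (h3.trans h5) h6).symm)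
  -- The two bounds for unions, with `d` the common dimension of the fibres.
  have hYG : ∀ k, k ≤ s ↔ k + d ≤ r := by
    intro k
    rw [hXG, ← WithBot.coe_le_coe (α := ℕ)]
    refine (hdimY k).trans ⟨fun h => h.union_of_fibers hloc hdc hAC
      fun x hx => (hdimF d x hx).1 le_rfl, fun h => ?_⟩
    refine LocOMin.RankGE.of_union_of_fibers hloc hdc hdisc hAC (fun x hx hr => ?_) h
    have : d + 1 ≤ d := by exact_mod_cast (hdimF (d + 1) x hx).2 hr
    omega
  have h1 := (hYG s).1 le_rfl
  -- The natural subtraction is exact, because `h1` gives `d ≤ r`.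
  have h2 := (hYG (r - d)).2 (by omega)
  rw [← hd, ← hr, ← hs]
  exact_mod_cast (by omega : r = s + d)
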